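/- Let $T=S^1\times S^1$ be the flat torus with coordinates $(m,l)\in(\mathbb R/2\pi\mathbb Z)^2$, oriented by $dm\wedge dl$, with Hodge star $*$. Identify $su(2)$ with the imaginary quaternions $\mathbb R i\oplus\mathbb C j$, and let $L^2=L^2(\Omega^{0+1+2}(T;su(2)))$ be the real Hilbert space of $su(2)$-valued forms. For a $1$-form $a\in\Omega^1(T;su(2))$ write $d_a=d+[a,\cdot\,]$ and let $$S_a(f,\beta,\gamma)=(*d_a\beta,\;-*d_af-d_a{*\gamma},\;d_a{*\beta})$$ be the twisted de Rham operator on smooth forms of degrees $0,1,2$. For $(\alpha,\beta)\in\mathbb R^2$ let $a_{\alpha,\beta}=-i\alpha\,dm-i\beta\,dl$, let $P^+_{\alpha,\beta}$ (resp. $P^-_{\alpha,\beta}$) be the closed real span in $L^2$ of the eigenforms of $S_{a_{\alpha,\beta}}$ with positive (resp. negative) eigenvalue, and let $\mathcal H^{0+1+2}_{(\alpha,\beta)}(T;\mathbb C j)$ be the space of $\mathbb Cj$-valued forms in the kernel of $\Delta_{a_{\alpha,\beta}}=d_ad_a^*+d_a^*d_a$ (with $a=a_{\alpha,\beta}$).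 Closed subspaces of $L^2$ carry the gap topology, given by the metric $\|\mathrm{proj}_V-\mathrm{proj}_W\|$. Let $\widetilde{\mathbb R}^2=\mathbb R^2\times S^1/\!\sim$, where $(\alpha,\beta,\theta)\sim(\alpha,\beta,1)$ if $(\alpha,\beta)\notin(\tfrac12\mathbb Z)^2$. Let $\eta:\mathbb R\to[0,1]$ be any smooth function which is $0$ on $(-\infty,\tfrac18]$, maps $[\tfrac18,\tfrac14]$ homeomorphically onto $[0,1]$, and is $1$ on $[\tfrac14,\infty)$. Give $\widetilde{\mathbb R}^2$ the topology for which the following bijection $h$ onto it, from the plane $\mathbb R^2=\mathbb C$ with the open disks of radius $\tfrac18$ about all points of $(\tfrac12\mathbb Z)^2$ removed, is a homeomorphism: $h(p+w)=[p+\eta(|w|)\,w,\;w/|w|]$ for $p\in(\tfrac12\mathbb Z)^2$ and $\tfrac18\le|w|\le\tfrac14$, and $h$ is the identity at distance at least $\tfrac14$ from $(\tfrac12\mathbb Z)^2$. Then, for each choice of sign $\pm$ (the same sign throughout): 1. $(\alpha,\beta)\mapsto P^\pm_{\alpha,\beta}$ is continuous on $\mathbb R^2\setminus(\tfrac12\mathbb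 Z)^2$. 2. For all $(\alpha,\beta)\in\mathbb R^2$ and all $\theta\in S^1\subset\mathbb C$ the limit $\lim_{t\to0^+}P^\pm_{(\alpha,\beta)+t(\operatorname{Re}\theta,\operatorname{Im}\theta)}$ exists and contains $P^\pm_{\alpha,\beta}$. The quotient $$K^\pm_{(\alpha,\beta,\theta)}:=\Big(\lim_{t\to0^+}P^\pm_{(\alpha,\beta)+t(\operatorname{Re}\theta,\operatorname{Im}\theta)}\Big)\Big/P^\pm_{\alpha,\beta},$$ realized as the orthogonal complement of $P^\pm_{\alpha,\beta}$ in the limit, is contained in $\mathcal H^{0+1+2}_{(\alpha,\beta)}(T;\mathbb Cj)$, and $K^\pm_{(\alpha,\beta,\theta)}=0$ for $(\alpha,\beta)\notin(\tfrac12\mathbb Z)^2$. 3. $(\alpha,\beta,\theta)\mapsto P^\pm_{\alpha,\beta}\oplus K^\pm_{(\alpha,\beta,\theta)}$ is well defined and continuous on $\widetilde{\mathbb R}^2$. 4. If $(\alpha,\beta)=\tfrac12(r,s)$ with $r,s\in\mathbb Z$, then $K^\pm_{(\alpha,\beta,\theta)}$ is the real span of $\psi_1^\pm j,\ \psi_2^\pm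 j,\ \psi_1^\pm k,\ \psi_2^\pm k$, and has real dimension $4$, where $$\psi_1^\pm=e^{i(rm+sl)}\big(1\mp(i\operatorname{Im}\theta\,dm-i\operatorname{Re}\theta\,dl)\big),\qquad \psi_2^\pm=e^{i(rm+sl)}\big(dm\wedge dl\pm(i\operatorname{Re}\theta\,dm+i\operatorname{Im}\theta\,dl)\big).$$ -/

import Mathlib

open Filter Topology MeasureTheory Quaternion
open scoped ContDiff

noncomputable section

namespace TorusDeRham

/-! ### The gap topology on closed subspaces -/

section Gap

variable {H : Type*} [NormedAddCommGroup H] [InnerProductSpace ℝ H] [CompleteSpace H]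

/-- The orthogonal projection of `H` onto a closed subspace, as a bounded operator on `H`. -/
def proj (K : ClosedSubmodule ℝ H) : H →L[ℝ] H := K.toSubmodule.starProjection

/-- The gap topology: it is induced by the gap metric `‖proj K - proj L‖`. -/
instance gapTopology : TopologicalSpace (ClosedSubmodule ℝ H) :=
  TopologicalSpace.induced proj inferInstance

instance : Nonempty (ClosedSubmodule ℝ H) := ⟨⊤⟩

/-- The gap topology is Hausdorff, so limits in it are unique. -/
instance : T2Space (ClosedSubmodule ℝ H) := by
  have hinj : Function.Injective (proj : ClosedSubmodule ℝ H → H →L[ℝ] H) := by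
    intro K L h
    apply ClosedSubmodule.toSubmodule_injective
    rw [← Submodule.range_starProjection K.toSubmodule,
      ← Submodule.range_starProjection L.toSubmodule]
    unfold proj at h
    rw [h]
  exact (Topology.IsEmbedding.mk ⟨rfl⟩ hinj).t2Space

end Gap

/-! ### The torus, the Lie algebra `su(2)` and forms -/

instance : Fact (0 < 2 * Real.pi) := ⟨Real.two_pi_pos⟩

/-- The flat torus `T = S¹ × S¹`, each factor of length `2π`, with coordinates `(m, l)`.
Its `volume` is the Riemannian one, of total mass `4π²`. -/
abbrev Torus : Type := AddCircle (2 * Real.pi) × AddCircle (2 * Real.pi)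

/-- `su(2)`, identified with the imaginary quaternions. -/
def su2 : Submodule ℝ ℍ[ℝ] where
  carrier := {q | q.re = 0}
  add_mem' := by
    intro a b (ha : a.re = 0) (hb : b.re = 0)
    show (a + b).re = 0
    simp [ha, hb]
  zero_mem' := rfl
  smul_mem' := by
    intro c a (ha : a.re = 0)
    show (c • a).re = 0
    simp [ha]

theorem mem_su2 {q : ℍ[ℝ]} : q ∈ su2 ↔ q.re = 0 := Iff.rfl

/-- The Lie bracket of `su(2)`: the commutator of imaginary quaternions. -/
def bracket (a b : su2) : su2 :=
  ⟨(a : ℍ[ℝ]) * b - b * a, by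
    rw [mem_su2]
    simp
    ring⟩

/-- `su(2)`-valued `0`-forms. -/
abbrev Form0 : Type := Torus → su2

/-- `su(2)`-valued `1`-forms; the pair `(b, c)` is `b dm + c dl`. -/
abbrev Form1 : Type := Torus → su2 × su2

/-- `su(2)`-valued `2`-forms; the value is the coefficient of `dm ∧ dl`. -/
abbrev Form2 : Type := Torus → su2

/-- The fibre of `Λ⁰⁺¹⁺²T*T ⊗ su(2)`: the coefficients of `1, dm, dl, dm ∧ dl`, in this order,
with the direct sum norm (this frame is orthonormal). -/
abbrev Fibre : Type := PiLp 2 (fun _ : Fin 4 => su2)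

/-- `su(2)`-valued forms of mixed degree `0 + 1 + 2`. -/
abbrev Form : Type := Torus → Fibre

/-- The part of degree `0`. -/
def deg0 (ψ : Form) : Form0 := fun x => ψ x 0

/-- The part of degree `1`. -/
def deg1 (ψ : Form) : Form1 := fun x => (ψ x 1, ψ x 2)

/-- The part of degree `2`. -/
def deg2 (ψ : Form) : Form2 := fun x => ψ x 3

/-- The form `(f, β, γ)` of mixed degree. -/
def mkForm (f : Form0) (β : Form1) (γ : Form2) : Form :=
  fun x => WithLp.toLp 2 ![f x, (β x).1, (β x).2, γ x]

/-- Smoothness on `T`, tested on the universal cover `ℝ²`. -/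
def IsSmooth (ψ : Form) : Prop :=
  ContDiff ℝ ∞ (fun p : ℝ × ℝ =>
    ψ ((p.1 : AddCircle (2 * Real.pi)), (p.2 : AddCircle (2 * Real.pi))))

/-- The partial derivative `∂/∂m`. -/
def partialM (f : Torus → su2) : Torus → su2 :=
  fun x => deriv (fun t : ℝ => f (x.1 + (t : AddCircle (2 * Real.pi)), x.2)) 0

/-- The partial derivative `∂/∂l`. -/
def partialL (f : Torus → su2) : Torus → su2 :=
  fun x => deriv (fun t : ℝ => f (x.1, x.2 + (t : AddCircle (2 * Real.pi)))) 0

/-- The covariant derivative in the direction `∂/∂m`. -/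
def nablaM (a : Form1) (f : Torus → su2) : Torus → su2 :=
  fun x => partialM f x + bracket (a x).1 (f x)

/-- The covariant derivative in the direction `∂/∂l`. -/
def nablaL (a : Form1) (f : Torus → su2) : Torus → su2 :=
  fun x => partialL f x + bracket (a x).2 (f x)

/-- `d_a f = df + [a, f]` on `0`-forms. -/
def d0 (a : Form1) (f : Form0) : Form1 := fun x => (nablaM a f x, nablaL a f x)

/-- `d_a β = dβ + [a ∧ β]` on `1`-forms. -/
def d1 (a : Form1) (β : Form1) : Form2 :=
  fun x => nablaM a (fun y => (β y).2) x - nablaL a (fun y => (β y).1) x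

/-- The Hodge star on `0`-forms: `*1 = dm ∧ dl`. -/
def star0 (f : Form0) : Form2 := f

/-- The Hodge star on `1`-forms: `*dm = dl` and `*dl = -dm`. -/
def star1 (β : Form1) : Form1 := fun x => (-(β x).2, (β x).1)

/-- The Hodge star on `2`-forms: `*(dm ∧ dl) = 1`. -/
def star2 (γ : Form2) : Form0 := γ

/-- The twisted de Rham operator
`S_a (f, β, γ) = (*d_a β, -*d_a f - d_a *γ, d_a *β)`. -/
def deRham (a : Form1) (ψ : Form) : Form :=
  mkForm (star2 (d1 a (deg1 ψ)))
    (-star1 (d0 a (deg0 ψ)) - d0 a (star2 (deg2 ψ)))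
    (d1 a (star1 (deg1 ψ)))

/-- The codifferential `d_a^* = -*d_a*` on `1`-forms. -/
def codiff1 (a : Form1) (β : Form1) : Form0 := -star2 (d1 a (star1 β))

/-- The codifferential `d_a^* = -*d_a*` on `2`-forms. -/
def codiff2 (a : Form1) (γ : Form2) : Form1 := -star1 (d0 a (star2 γ))

/-- The twisted Laplacian `Δ_a = d_a d_a^* + d_a^* d_a`. -/
def laplacian (a : Form1) (ψ : Form) : Form :=
  mkForm (codiff1 a (d0 a (deg0 ψ)))
    (d0 a (codiff1 a (deg1 ψ)) + codiff2 a (d1 a (deg1 ψ)))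
    (d1 a (codiff2 a (deg2 ψ)))

/-- The real Hilbert space `L²(Ω⁰⁺¹⁺²(T; su(2)))`. -/
abbrev L2Forms : Type := Lp Fibre 2 (volume : Measure Torus)

/-! ### Spectral subspaces -/

/-- `ψ` is (the class of) a smooth form with `S_a ψ = μ ψ`. -/
def IsEigenform (a : Form1) (μ : ℝ) (ψ : L2Forms) : Prop :=
  ∃ f : Form, IsSmooth f ∧ (ψ =ᵐ[volume] f) ∧ deRham a f = μ • f

/-- For `σ = 1` resp. `σ = -1`, the positive resp. negative spectral subspace `P⁺_a` resp. `P⁻_a`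
of `S_a`: the closed span of the eigenforms whose eigenvalue is positive resp. negative. -/
def spectralSubspace (σ : ℤˣ) (a : Form1) : ClosedSubmodule ℝ L2Forms :=
  (Submodule.span ℝ {ψ : L2Forms | ∃ μ : ℝ, 0 < ((σ : ℤ) : ℝ) * μ ∧ IsEigenform a μ ψ}).closure

/-- The flat connection `a_{α,β} = -iα dm - iβ dl`, where `z = α + iβ`. -/
def flatConnection (z : ℂ) : Form1 :=
  fun _ => (⟨⟨0, -z.re, 0, 0⟩, rfl⟩, ⟨⟨0, -z.im, 0, 0⟩, rfl⟩)

/-- `P^±_{α,β}`, where `z = α + iβ`. -/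
def P (σ : ℤˣ) (z : ℂ) : ClosedSubmodule ℝ L2Forms := spectralSubspace σ (flatConnection z)

/-- The harmonic forms `H⁰⁺¹⁺²_{α,β}(T; ℂj)`, where `z = α + iβ`: smooth forms in the kernel of the
Laplacian twisted by `a_{α,β}` all of whose coefficients lie in `ℂj = ℝj ⊕ ℝk`. -/
def harmonicCj (z : ℂ) : Set L2Forms :=
  {ψ | ∃ f : Form, IsSmooth f ∧ (ψ =ᵐ[volume] f) ∧ laplacian (flatConnection z) f = 0 ∧
    ∀ x n, ((f x n : su2) : ℍ[ℝ]).imI = 0}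

/-- The limit of `P^±` at `z` along the ray in direction `θ`. -/
def limP (σ : ℤˣ) (z : ℂ) (θ : Circle) : ClosedSubmodule ℝ L2Forms :=
  limUnder (𝓝[>] (0 : ℝ)) (fun t : ℝ => P σ (z + (t : ℂ) * (θ : ℂ)))

/-- `K^±_{(α,β,θ)}`: the quotient of the limit of `P^±` along the ray by `P^±_{α,β}`, realized in
`L²` as the orthogonal complement of `P^±_{α,β}` in that limit. -/
def K (σ : ℤˣ) (z : ℂ) (θ : Circle) : ClosedSubmodule ℝ L2Forms :=
  limP σ z θ ⊓ (P σ z)ᗮ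

/-! ### The explicit forms -/

/-- The `L²` class of the form whose coefficients with respect to `1, dm, dl, dm ∧ dl` are
`e^{i(rm+sl)} c₀ u, …, e^{i(rm+sl)} c₃ u`, for complex constants `c` and `u` one of `j, k`. -/
def expForm (r s : ℤ) (c : Fin 4 → ℂ) (u : ℍ[ℝ]) (hu : u.re = 0 ∧ u.imI = 0) : L2Forms :=
  ContinuousMap.toLp 2 (volume : Measure Torus) ℝ
    (⟨fun x => WithLp.toLp 2 (fun n =>
        (⟨((fourier r x.1 * fourier s x.2 * c n : ℂ) : ℍ[ℝ]) * u, by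
          simp [mem_su2, hu.1, hu.2]⟩ : su2)), by
      refine (PiLp.continuous_toLp 2 _).comp (continuous_pi fun n => ?_)
      refine Continuous.subtype_mk (Continuous.mul ?_ continuous_const) _
      refine (LinearMap.continuous_of_finiteDimensional
        Quaternion.ofComplex.toLinearMap).comp ?_
      fun_prop⟩ : C(Torus, Fibre))

/-- The quaternion `j`. -/
def qj : ℍ[ℝ] := ⟨0, 0, 1, 0⟩

/-- The quaternion `k`. -/
def qk : ℍ[ℝ] := ⟨0, 0, 0, 1⟩

/-- The constants of `ψ₁^± = e^{i(rm+sl)} (1 ∓ (i Im θ dm - i Re θ dl))`. -/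
def psi1 (σ : ℤˣ) (θ : Circle) : Fin 4 → ℂ :=
  ![1, -((σ : ℤ) : ℂ) * (Complex.I * ((θ : ℂ).im : ℂ)),
    ((σ : ℤ) : ℂ) * (Complex.I * ((θ : ℂ).re : ℂ)), 0]

/-- The constants of `ψ₂^± = e^{i(rm+sl)} (dm ∧ dl ± (i Re θ dm + i Im θ dl))`. -/
def psi2 (σ : ℤˣ) (θ : Circle) : Fin 4 → ℂ :=
  ![0, ((σ : ℤ) : ℂ) * (Complex.I * ((θ : ℂ).re : ℂ)),
    ((σ : ℤ) : ℂ) * (Complex.I * ((θ : ℂ).im : ℂ)), 1]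

/-! ### The blow-up of the plane at the half-integer lattice -/

/-- The half-integer lattice `(½ℤ)²` in `ℝ² = ℂ`. -/
def halfLattice : Set ℂ := {z | ∃ r s : ℤ, z = ⟨(r : ℝ) / 2, (s : ℝ) / 2⟩}

/-- The relation on `ℝ² × S¹` that collapses the circle over each point off the lattice. -/
def blowUpSetoid : Setoid (ℂ × Circle) where
  r x y := x.1 = y.1 ∧ (x.2 = y.2 ∨ x.1 ∉ halfLattice)
  iseqv :=
    { refl := fun _ => ⟨rfl, Or.inl rfl⟩
      symm := by
        rintro x y ⟨h, h'⟩
        exact ⟨h.symm, h'.imp Eq.symm (fun hx => h ▸ hx)⟩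
      trans := by
        rintro x y w ⟨h, h'⟩ ⟨g, g'⟩
        refine ⟨h.trans g, ?_⟩
        rcases h' with h' | h'
        · rcases g' with g' | g'
          · exact Or.inl (h'.trans g')
          · exact Or.inr (h ▸ g')
        · exact Or.inr h' }

/-- The set `ℝ̃² = ℝ² × S¹ / ∼`. -/
def BlowUp : Type := Quotient blowUpSetoid

/-- The class of `(α, β, θ)`, where `z = α + iβ`. -/
def BlowUp.mk (z : ℂ) (θ : Circle) : BlowUp := Quotient.mk blowUpSetoid (z, θ)

/-- The plane with the open disks of radius `1/8` about all half-integer lattice points removed. -/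
abbrev PuncturedPlane : Type := {z : ℂ // ∀ p ∈ halfLattice, 1 / 8 ≤ dist z p}

/-- The smooth cutoff functions: `0` up to `1/8`, a homeomorphism of `[1/8, 1/4]` onto `[0, 1]`,
and `1` from `1/4` on. -/
def IsCutoff (η : ℝ → ℝ) : Prop :=
  ContDiff ℝ ∞ η ∧ (∀ t ≤ 1 / 8, η t = 0) ∧
    Set.BijOn η (Set.Icc (1 / 8) (1 / 4)) (Set.Icc 0 1) ∧ ∀ t, 1 / 4 ≤ t → η t = 1

/-- The half-integer lattice point nearest to `z`. -/
def nearest (z : ℂ) : ℂ := ⟨(round (2 * z.re) : ℝ) / 2, (round (2 * z.im) : ℝ) / 2⟩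

/-- The bijection `h`: with `p` the lattice point nearest to `z` and `w = z - p`, it sends `z` to
the class of `(p + η(|w|) w, w / |w|)`. For `|w| ≥ 1/4` this is the class of the point `z`
itself, which is then not a lattice point. -/
def collapse (η : ℝ → ℝ) (z : PuncturedPlane) : BlowUp :=
  BlowUp.mk (nearest z.1 + (η ‖z.1 - nearest z.1‖ : ℂ) * (z.1 - nearest z.1))
    (Circle.exp (Complex.arg (z.1 - nearest z.1)))

/-- The topology on `ℝ̃²` that makes the bijection `h` a homeomorphism. -/
abbrev blowUpTopology (η : ℝ → ℝ) : TopologicalSpace BlowUp :=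
  TopologicalSpace.coinduced (collapse η) inferInstance

end TorusDeRham

end

open TorusDeRham

/-! Everything reduces to Fourier multipliers. The coefficients split as `ℝi ⊕ ℂj`. On `ℝi` the
bracket with the connection vanishes, so neither the operator nor its spectral projection depends on
`z` there (`proj_P_projI`). On `ℂj` the bracket is multiplication by `-2iα` or `-2iβ`, so on the
Fourier mode `n = (r, s)` the operator becomes the matrix `symb ξ` with `ξ = freq n - 2 * z`
(`deRham_modeForm`). Its square is `|ξ|²`. For `ξ ≠ 0` the projection onto the part of sign `σ` is
therefore `(1 + σ symb (ξ/|ξ|)) / 2`, which sees only the direction of `ξ`; for `ξ = 0` the mode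
lies in the kernel and the projection is `0` (`proj_P_mode`). Symmetry of the operator gives the
orthogonality that identifies these projections.

Modes of different frequency are orthogonal, and together with the `ℝi`-valued forms they span a
dense subspace. Hence the gap distance of two multipliers is at most four times the supremum of the
distances of their directions (`IsMultiplier.norm_sub_le`). The nonzero frequencies at `z` are
bounded away from `0`, so their directions vary uniformly little near `z`. Only a mode with `freq n
= 2 * z` can jump; it exists exactly when `z` is in the half-integer lattice, and is then unique.

Along the ray `z + tθ` that mode has frequency `-2tθ`, of constant direction `-θ`. The limit is thus
`P` plus the range of `spec σ (-θ)` on that mode. This range, `limitKernel`, is orthogonal to `P`,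
hence equals `K` (`K_eq`), and it is the complex plane spanned by `psi1` and `psi2`.

On the blow-up, `p + w` goes to `p + η(|w|) w` with angle `w/|w|`. The critical direction is
`-w/|w|` whether or not `η(|w|)` vanishes (`blowUpDir_collapse`), which is continuous in `w`. -/

noncomputable section

namespace TorusDeRham

/-! ### Calculus on the torus -/

section Calculus

variable {E F : Type*} [NormedAddCommGroup E] [NormedSpace ℝ E]
  [NormedAddCommGroup F] [NormedSpace ℝ F]

/-- The universal covering of the torus. -/
def cover (p : ℝ × ℝ) : Torus :=
  ((p.1 : AddCircle (2 * Real.pi)), (p.2 : AddCircle (2 * Real.pi)))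

theorem cover_add (p q : ℝ × ℝ) : cover (p + q) = cover p + cover q := by
  simp [cover]

theorem cover_zero : cover 0 = 0 := by
  simp [cover]

theorem isOpenQuotientMap_cover : IsOpenQuotientMap cover :=
  IsOpenQuotientMap.prodMap QuotientAddGroup.isOpenQuotientMap_mk
    QuotientAddGroup.isOpenQuotientMap_mk

/-- Smoothness of functions on the torus, tested on the universal cover. -/
def TorusSmooth (g : Torus → E) : Prop := ContDiff ℝ ∞ (fun p => g (cover p))

theorem TorusSmooth.continuous {g : Torus → E} (hg : TorusSmooth g) : Continuous g :=
  isOpenQuotientMap_cover.isQuotientMap.continuous_iff.2 (ContDiff.continuous hg)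

theorem TorusSmooth.clm {g : Torus → E} (hg : TorusSmooth g) (L : E →L[ℝ] F) :
    TorusSmooth (fun x => L (g x)) :=
  L.contDiff.comp hg

theorem TorusSmooth.inner {E : Type*} [NormedAddCommGroup E] [InnerProductSpace ℝ E]
    {g h : Torus → E} (hg : TorusSmooth g) (hh : TorusSmooth h) :
    TorusSmooth (fun x => inner ℝ (g x) (h x)) :=
  ContDiff.inner ℝ hg hh

theorem TorusSmooth.add {g h : Torus → E} (hg : TorusSmooth g) (hh : TorusSmooth h) :
    TorusSmooth (fun x => g x + h x) :=
  ContDiff.add hg hh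

theorem TorusSmooth.sub {g h : Torus → E} (hg : TorusSmooth g) (hh : TorusSmooth h) :
    TorusSmooth (fun x => g x - h x) :=
  ContDiff.sub hg hh

/-- The derivative of a function on the torus in a constant direction. -/
def dirDeriv (v : ℝ × ℝ) (g : Torus → E) : Torus → E :=
  fun x => deriv (fun t : ℝ => g (x + cover (t • v))) 0

theorem partialM_eq (f : Torus → su2) : partialM f = dirDeriv (1, 0) f := by
  funext x
  simp only [partialM, dirDeriv]
  congr 1
  funext t
  congr 1
  ext <;> simp [cover]

theorem partialL_eq (f : Torus → su2) : partialL f = dirDeriv (0, 1) f := by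
  funext x
  simp only [partialL, dirDeriv]
  congr 1
  funext t
  congr 1
  ext <;> simp [cover]

theorem TorusSmooth.hasDerivAt_cover {g : Torus → E} (hg : TorusSmooth g) (v p : ℝ × ℝ) (t : ℝ) :
    HasDerivAt (fun t : ℝ => g (cover p + cover (t • v)))
      (fderiv ℝ (fun p => g (cover p)) (p + t • v) v) t := by
  have h1 : HasFDerivAt (fun p => g (cover p)) (fderiv ℝ (fun p => g (cover p)) (p + t • v))
      (p + t • v) := ((ContDiff.differentiable hg (by simp)) _).hasFDerivAt
  have h2 : HasDerivAt (fun t : ℝ => p + t • v) v t := by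
    simpa using ((hasDerivAt_id t).smul_const v).const_add p
  have h3 := h1.comp_hasDerivAt t h2
  refine h3.congr_of_eventuallyEq (Eventually.of_forall fun s => ?_)
  simp [cover_add]

theorem TorusSmooth.dirDeriv_cover {g : Torus → E} (hg : TorusSmooth g) (v p : ℝ × ℝ) :
    dirDeriv v g (cover p) = fderiv ℝ (fun p => g (cover p)) p v := by
  simpa [dirDeriv] using (hg.hasDerivAt_cover v p 0).deriv

theorem TorusSmooth.hasDerivAt {g : Torus → E} (hg : TorusSmooth g) (v : ℝ × ℝ) (x : Torus)
    (t : ℝ) :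
    HasDerivAt (fun t : ℝ => g (x + cover (t • v))) (dirDeriv v g (x + cover (t • v))) t := by
  obtain ⟨p, rfl⟩ := isOpenQuotientMap_cover.surjective x
  rw [← cover_add, hg.dirDeriv_cover]
  exact hg.hasDerivAt_cover v p t

theorem TorusSmooth.hasDerivAt_zero {g : Torus → E} (hg : TorusSmooth g) (v : ℝ × ℝ)
    (x : Torus) : HasDerivAt (fun t : ℝ => g (x + cover (t • v))) (dirDeriv v g x) 0 := by
  simpa [cover_zero] using hg.hasDerivAt v x 0

theorem dirDeriv_eq {g : Torus → E} {v : ℝ × ℝ} {x : Torus} {g' : E}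
    (h : HasDerivAt (fun t : ℝ => g (x + cover (t • v))) g' 0) : dirDeriv v g x = g' :=
  h.deriv

theorem dirDeriv_add {g h : Torus → E} (hg : TorusSmooth g) (hh : TorusSmooth h) (v : ℝ × ℝ)
    (x : Torus) : dirDeriv v (fun x => g x + h x) x = dirDeriv v g x + dirDeriv v h x :=
  dirDeriv_eq ((hg.hasDerivAt_zero v x).add (hh.hasDerivAt_zero v x))

theorem dirDeriv_sub {g h : Torus → E} (hg : TorusSmooth g) (hh : TorusSmooth h) (v : ℝ × ℝ)
    (x : Torus) : dirDeriv v (fun x => g x - h x) x = dirDeriv v g x - dirDeriv v h x :=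
  dirDeriv_eq ((hg.hasDerivAt_zero v x).sub (hh.hasDerivAt_zero v x))

theorem dirDeriv_clm {g : Torus → E} (hg : TorusSmooth g) (L : E →L[ℝ] F) (v : ℝ × ℝ)
    (x : Torus) : dirDeriv v (fun x => L (g x)) x = L (dirDeriv v g x) :=
  dirDeriv_eq (L.hasFDerivAt.comp_hasDerivAt (0 : ℝ) (hg.hasDerivAt_zero v x))

theorem TorusSmooth.continuous_dirDeriv {g : Torus → E} (hg : TorusSmooth g) (v : ℝ × ℝ) :
    Continuous (dirDeriv v g) := by
  refine isOpenQuotientMap_cover.isQuotientMap.continuous_iff.2 ?_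
  have : dirDeriv v g ∘ cover = fun p => fderiv ℝ (fun p => g (cover p)) p v := by
    funext p
    exact hg.dirDeriv_cover v p
  rw [this]
  exact (ContDiff.continuous_fderiv hg (by simp)).clm_apply continuous_const

theorem continuous_integrable {E : Type*} [NormedAddCommGroup E] {g : Torus → E} (hg : Continuous g) :
    Integrable g (volume : Measure Torus) := by
  refine hg.integrable_of_hasCompactSupport ?_
  exact HasCompactSupport.of_compactSpace g

/-- The integral of a translate does not depend on the translation; differentiating under the
integral sign gives the claim. This plays the role of Stokes' theorem on the torus. -/
theorem TorusSmooth.integral_dirDeriv {g : Torus → ℝ} (hg : TorusSmooth g) (v : ℝ × ℝ) :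
    ∫ x, dirDeriv v g x = 0 := by
  obtain ⟨C, hC⟩ := isCompact_univ.exists_bound_of_continuousOn
    (hg.continuous_dirDeriv v).continuousOn
  have h := (hasDerivAt_integral_of_dominated_loc_of_deriv_le
    (F := fun (t : ℝ) (x : Torus) => g (x + cover (t • v)))
    (F' := fun (t : ℝ) (x : Torus) => dirDeriv v g (x + cover (t • v)))
    (bound := fun _ => C) (μ := (volume : Measure Torus)) (x₀ := (0 : ℝ)) (s := Set.univ)
    univ_mem
    (Eventually.of_forall fun t =>
      (hg.continuous.comp (continuous_add_const _)).aestronglyMeasurable)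
    (continuous_integrable (hg.continuous.comp (continuous_add_const _)))
    (((hg.continuous_dirDeriv v).comp (continuous_add_const _)).aestronglyMeasurable)
    (Eventually.of_forall fun x t _ => hC _ (Set.mem_univ _))
    (integrable_const _)
    (Eventually.of_forall fun x t _ => hg.hasDerivAt v x t)).2
  have h2 : (fun t : ℝ => ∫ x, g (x + cover (t • v))) = fun _ => ∫ x, g x := by
    funext t
    have : (volume : Measure Torus).IsAddLeftInvariant := by
      rw [Measure.volume_eq_prod]
      infer_instance
    simp_rw [add_comm _ (cover (t • v))]
    exact integral_add_left_eq_self g _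
  rw [h2] at h
  have h3 := h.unique (hasDerivAt_const _ _)
  simpa [cover_zero] using h3

end Calculus

/-! ### The twisted de Rham operator is symmetric -/

theorem su2_inner (a b : su2) : inner ℝ a b =
    (a : ℍ[ℝ]).imI * (b : ℍ[ℝ]).imI + (a : ℍ[ℝ]).imJ * (b : ℍ[ℝ]).imJ +
      (a : ℍ[ℝ]).imK * (b : ℍ[ℝ]).imK := by
  have ha : (a : ℍ[ℝ]).re = 0 := a.2
  have hb : (b : ℍ[ℝ]).re = 0 := b.2
  rw [Submodule.coe_inner, Quaternion.inner_def]
  simp [ha, hb]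

/-- Invariance of the metric under the adjoint action; it makes the zeroth-order part of the
covariant derivatives skew. -/
theorem inner_bracket (a b c : su2) :
    inner ℝ (bracket a b) c = -inner ℝ b (bracket a c) := by
  have ha : (a : ℍ[ℝ]).re = 0 := a.2
  have hb : (b : ℍ[ℝ]).re = 0 := b.2
  have hc : (c : ℍ[ℝ]).re = 0 := c.2
  simp only [su2_inner, bracket]
  simp [ha, hb, hc]
  ring

theorem fibre_inner (v w : Fibre) : inner ℝ v w =
    inner ℝ (v 0) (w 0) + inner ℝ (v 1) (w 1) + inner ℝ (v 2) (w 2) + inner ℝ (v 3) (w 3) := by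
  rw [PiLp.inner_apply, Fin.sum_univ_four]

theorem TorusSmooth.coeff {ψ : Form} (h : TorusSmooth ψ) (k : Fin 4) :
    TorusSmooth (fun x => ψ x k) :=
  h.clm (PiLp.proj 2 (fun _ : Fin 4 => su2) k : Fibre →L[ℝ] su2)

theorem dirDeriv_inner {f g : Torus → su2} (hf : TorusSmooth f) (hg : TorusSmooth g)
    (v : ℝ × ℝ) (x : Torus) :
    dirDeriv v (fun x => inner ℝ (f x) (g x)) x =
      inner ℝ (f x) (dirDeriv v g x) + inner ℝ (dirDeriv v f x) (g x) := by
  refine dirDeriv_eq ?_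
  simpa [cover_zero] using (hf.hasDerivAt_zero v x).inner ℝ (hg.hasDerivAt_zero v x)

theorem inner_nablaM {f g : Torus → su2} (hf : TorusSmooth f) (hg : TorusSmooth g)
    (a : Form1) (x : Torus) :
    inner ℝ (nablaM a f x) (g x) = dirDeriv (1, 0) (fun x => inner ℝ (f x) (g x)) x
      - inner ℝ (f x) (nablaM a g x) := by
  rw [dirDeriv_inner hf hg, nablaM, nablaM, inner_add_left, inner_add_right, inner_bracket,
    partialM_eq, partialM_eq]
  ring

theorem inner_nablaL {f g : Torus → su2} (hf : TorusSmooth f) (hg : TorusSmooth g)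
    (a : Form1) (x : Torus) :
    inner ℝ (nablaL a f x) (g x) = dirDeriv (0, 1) (fun x => inner ℝ (f x) (g x)) x
      - inner ℝ (f x) (nablaL a g x) := by
  rw [dirDeriv_inner hf hg, nablaL, nablaL, inner_add_left, inner_add_right, inner_bracket,
    partialL_eq, partialL_eq]
  ring

theorem nablaL_neg (a : Form1) (f : Torus → su2) (x : Torus) :
    nablaL a (fun y => -f y) x = -nablaL a f x := by
  have hb : bracket (a x).2 (-f x) = -bracket (a x).2 (f x) := by
    ext <;> simp [bracket] <;> ring
  simp only [nablaL, hb, partialL]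
  rw [deriv.fun_neg]
  abel

theorem deRham_zero (a : Form1) (ψ : Form) (x : Torus) : deRham a ψ x 0 =
    nablaM a (fun y => ψ y 2) x - nablaL a (fun y => ψ y 1) x := rfl

theorem deRham_one (a : Form1) (ψ : Form) (x : Torus) : deRham a ψ x 1 =
    nablaL a (fun y => ψ y 0) x - nablaM a (fun y => ψ y 3) x := by
  change - -nablaL a (fun y => ψ y 0) x - nablaM a (fun y => ψ y 3) x = _
  rw [neg_neg]

theorem deRham_two (a : Form1) (ψ : Form) (x : Torus) : deRham a ψ x 2 =
    -nablaM a (fun y => ψ y 0) x - nablaL a (fun y => ψ y 3) x := rfl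

theorem deRham_three (a : Form1) (ψ : Form) (x : Torus) : deRham a ψ x 3 =
    nablaM a (fun y => ψ y 1) x + nablaL a (fun y => ψ y 2) x := by
  change nablaM a (fun y => ψ y 1) x - nablaL a (fun y => -ψ y 2) x = _
  rw [nablaL_neg, sub_neg_eq_add]

/-- The covariant derivatives are skew up to a total derivative, so the integrand is the divergence
of the vector field whose components are the functions in `hU` and `hV`. -/
theorem integral_deRham_symm (a : Form1) {ψ φ : Form} (hψ : TorusSmooth ψ) (hφ : TorusSmooth φ) :
    ∫ x, inner ℝ (deRham a ψ x) (φ x) - inner ℝ (ψ x) (deRham a φ x) = 0 := by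
  have hp := hψ.coeff
  have hq := hφ.coeff
  have hU : TorusSmooth (fun x => inner ℝ (ψ x 2) (φ x 0) - inner ℝ (ψ x 3) (φ x 1)
      - inner ℝ (ψ x 0) (φ x 2) + inner ℝ (ψ x 1) (φ x 3)) :=
    ((((hp 2).inner (hq 0)).sub ((hp 3).inner (hq 1))).sub ((hp 0).inner (hq 2))).add
      ((hp 1).inner (hq 3))
  have hV : TorusSmooth (fun x => inner ℝ (ψ x 0) (φ x 1) - inner ℝ (ψ x 1) (φ x 0)
      - inner ℝ (ψ x 3) (φ x 2) + inner ℝ (ψ x 2) (φ x 3)) :=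
    ((((hp 0).inner (hq 1)).sub ((hp 1).inner (hq 0))).sub ((hp 3).inner (hq 2))).add
      ((hp 2).inner (hq 3))
  have key : ∀ x, inner ℝ (deRham a ψ x) (φ x) - inner ℝ (ψ x) (deRham a φ x) =
      dirDeriv (1, 0) (fun x => inner ℝ (ψ x 2) (φ x 0) - inner ℝ (ψ x 3) (φ x 1)
        - inner ℝ (ψ x 0) (φ x 2) + inner ℝ (ψ x 1) (φ x 3)) x +
      dirDeriv (0, 1) (fun x => inner ℝ (ψ x 0) (φ x 1) - inner ℝ (ψ x 1) (φ x 0)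
        - inner ℝ (ψ x 3) (φ x 2) + inner ℝ (ψ x 2) (φ x 3)) x := by
    intro x
    have s1 := ((hp 2).inner (hq 0)).sub ((hp 3).inner (hq 1))
    have s2 := s1.sub ((hp 0).inner (hq 2))
    have t1 := ((hp 0).inner (hq 1)).sub ((hp 1).inner (hq 0))
    have t2 := t1.sub ((hp 3).inner (hq 2))
    rw [dirDeriv_add s2 ((hp 1).inner (hq 3)), dirDeriv_sub s1 ((hp 0).inner (hq 2)),
      dirDeriv_sub ((hp 2).inner (hq 0)) ((hp 3).inner (hq 1)),
      dirDeriv_add t2 ((hp 2).inner (hq 3)), dirDeriv_sub t1 ((hp 3).inner (hq 2)),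
      dirDeriv_sub ((hp 0).inner (hq 1)) ((hp 1).inner (hq 0)), fibre_inner, fibre_inner]
    simp only [deRham_zero, deRham_one, deRham_two, deRham_three, inner_add_left, inner_sub_left,
      inner_neg_left, inner_add_right, inner_sub_right, inner_neg_right]
    have m := fun i j => inner_nablaM (hp i) (hq j) a x
    have l := fun i j => inner_nablaL (hp i) (hq j) a x
    simp only [m, l]
    ring
  simp_rw [key]
  rw [integral_add (continuous_integrable (hU.continuous_dirDeriv _))
    (continuous_integrable (hV.continuous_dirDeriv _)), hU.integral_dirDeriv, hV.integral_dirDeriv,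
    add_zero]

/-- Eigenforms for different eigenvalues are orthogonal. -/
theorem IsEigenform.inner_eq_zero {a : Form1} {μ ν : ℝ} {ψ φ : L2Forms}
    (hψ : IsEigenform a μ ψ) (hφ : IsEigenform a ν φ) (h : μ ≠ ν) : inner ℝ ψ φ = 0 := by
  obtain ⟨f, hf, hψf, hSf⟩ := hψ
  obtain ⟨g, hg, hφg, hSg⟩ := hφ
  have h1 := integral_deRham_symm a hf hg
  rw [hSf, hSg] at h1
  have h2 : ∫ x, inner ℝ (f x) (g x) = inner ℝ ψ φ := by
    rw [L2.inner_def]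
    refine integral_congr_ae ?_
    filter_upwards [hψf, hφg] with x hx hy
    rw [hx, hy]
  have h3 : ∀ x, inner ℝ ((μ • f) x) (g x) - inner ℝ (f x) ((ν • g) x) =
      (μ - ν) * inner ℝ (f x) (g x) := by
    intro x
    have e1 : inner ℝ ((μ • f) x) (g x) = μ * inner ℝ (f x) (g x) :=
      real_inner_smul_left (f x) (g x) μ
    have e2 : inner ℝ (f x) ((ν • g) x) = ν * inner ℝ (f x) (g x) :=
      real_inner_smul_right (f x) (g x) ν
    rw [e1, e2, sub_mul]
  simp_rw [h3] at h1
  rw [integral_const_mul, h2] at h1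
  exact (mul_eq_zero.1 h1).resolve_left (sub_ne_zero.2 h)

/-! ### Fourier modes -/

theorem su2_ext {p q : su2} (hI : (p : ℍ[ℝ]).imI = (q : ℍ[ℝ]).imI)
    (hJ : (p : ℍ[ℝ]).imJ = (q : ℍ[ℝ]).imJ) (hK : (p : ℍ[ℝ]).imK = (q : ℍ[ℝ]).imK) : p = q :=
  Subtype.ext (QuaternionAlgebra.ext ((mem_su2.1 p.2).trans (mem_su2.1 q.2).symm) hI hJ hK)

/-- The element of `su(2)` with coordinates `a, b, c` with respect to `i, j, k`. -/
def su2Mk (a b c : ℝ) : su2 := ⟨⟨0, a, b, c⟩, rfl⟩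

@[simp] theorem su2_re (q : su2) : (q : ℍ[ℝ]).re = 0 := q.2
@[simp] theorem su2Mk_imI (a b c : ℝ) : (su2Mk a b c : ℍ[ℝ]).imI = a := rfl
@[simp] theorem su2Mk_imJ (a b c : ℝ) : (su2Mk a b c : ℍ[ℝ]).imJ = b := rfl
@[simp] theorem su2Mk_imK (a b c : ℝ) : (su2Mk a b c : ℍ[ℝ]).imK = c := rfl

/-- The inclusion `w ↦ w j` of `ℂ` in `su(2)`. -/
def mulJ : ℂ →L[ℝ] su2 := LinearMap.toContinuousLinearMap
  { toFun := fun w => su2Mk 0 w.re w.im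
    map_add' := fun v w => by apply su2_ext <;> simp
    map_smul' := fun r w => by apply su2_ext <;> simp }

/-- The `ℂj` component of an element of `su(2)`. -/
def coordJ : su2 →L[ℝ] ℂ := LinearMap.toContinuousLinearMap
  { toFun := fun q => ⟨(q : ℍ[ℝ]).imJ, (q : ℍ[ℝ]).imK⟩
    map_add' := fun v w => by apply Complex.ext <;> simp
    map_smul' := fun r w => by apply Complex.ext <;> simp }

/-- The projection of `su(2)` onto `ℝi`. -/
def partI : su2 →L[ℝ] su2 := LinearMap.toContinuousLinearMap
  { toFun := fun q => su2Mk (q : ℍ[ℝ]).imI 0 0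
    map_add' := fun v w => by apply su2_ext <;> simp
    map_smul' := fun r w => by apply su2_ext <;> simp }

@[simp] theorem mulJ_imI (w : ℂ) : (mulJ w : ℍ[ℝ]).imI = 0 := rfl
@[simp] theorem mulJ_imJ (w : ℂ) : (mulJ w : ℍ[ℝ]).imJ = w.re := rfl
@[simp] theorem mulJ_imK (w : ℂ) : (mulJ w : ℍ[ℝ]).imK = w.im := rfl
@[simp] theorem coordJ_re (q : su2) : (coordJ q).re = (q : ℍ[ℝ]).imJ := rfl
@[simp] theorem coordJ_im (q : su2) : (coordJ q).im = (q : ℍ[ℝ]).imK := rfl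
@[simp] theorem partI_imI (q : su2) : (partI q : ℍ[ℝ]).imI = (q : ℍ[ℝ]).imI := rfl
@[simp] theorem partI_imJ (q : su2) : (partI q : ℍ[ℝ]).imJ = 0 := rfl
@[simp] theorem partI_imK (q : su2) : (partI q : ℍ[ℝ]).imK = 0 := rfl

theorem flatConnection_fst (z : ℂ) (x : Torus) : (flatConnection z x).1 = su2Mk (-z.re) 0 0 := rfl
theorem flatConnection_snd (z : ℂ) (x : Torus) : (flatConnection z x).2 = su2Mk (-z.im) 0 0 := rfl

/-- The bracket with `ai` kills `ℝi` and multiplies `ℂj` by `2ai`. This factor `2` is why the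
exceptional points are half-integers. -/
theorem bracket_su2Mk (a : ℝ) (q : su2) :
    bracket (su2Mk a 0 0) q = su2Mk 0 (-2 * a * (q : ℍ[ℝ]).imK) (2 * a * (q : ℍ[ℝ]).imJ) := by
  apply su2_ext <;> simp [bracket] <;> ring

theorem partI_add_mulJ (q : su2) : partI q + mulJ (coordJ q) = q := by
  apply su2_ext <;> simp

theorem inner_mulJ (v w : ℂ) : inner ℝ (mulJ v) (mulJ w) = v.re * w.re + v.im * w.im := by
  rw [su2_inner]; simp

theorem inner_partI (p q : su2) : inner ℝ (partI p) q = inner ℝ p (partI q) := by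
  rw [su2_inner, su2_inner]; simp

theorem partI_mulJ (w : ℂ) : partI (mulJ w) = 0 := by
  apply su2_ext <;> simp

theorem partI_partI (q : su2) : partI (partI q) = partI q := by
  apply su2_ext <;> simp

/-- The projection of the fibre onto the forms with coefficients in `ℝi`. -/
def fibreI : Fibre →L[ℝ] Fibre := LinearMap.toContinuousLinearMap
  { toFun := fun v => WithLp.toLp 2 (fun k => partI (v k))
    map_add' := fun v w => PiLp.ext fun k => map_add partI (v k) (w k)
    map_smul' := fun r w => PiLp.ext fun k => map_smul partI r (w k) }

/-- The inclusion of `ℂ⁴` in the fibre as the space of forms with coefficients in `ℂj`. -/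
def fibreJ : (Fin 4 → ℂ) →L[ℝ] Fibre := LinearMap.toContinuousLinearMap
  { toFun := fun c => WithLp.toLp 2 (fun k => mulJ (c k))
    map_add' := fun v w => PiLp.ext fun k => map_add mulJ (v k) (w k)
    map_smul' := fun r w => PiLp.ext fun k => map_smul mulJ r (w k) }

theorem fibreI_apply (v : Fibre) (k : Fin 4) : fibreI v k = partI (v k) := rfl

theorem fibreJ_apply (c : Fin 4 → ℂ) (k : Fin 4) : fibreJ c k = mulJ (c k) := rfl

theorem inner_fibreI (v w : Fibre) : inner ℝ (fibreI v) w = inner ℝ v (fibreI w) := by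
  simp only [fibre_inner, fibreI_apply, inner_partI]

theorem fibreI_fibreI (v : Fibre) : fibreI (fibreI v) = fibreI v := by
  refine PiLp.ext fun k => ?_
  simp only [fibreI_apply, partI_partI]

theorem fibreI_fibreJ (c : Fin 4 → ℂ) : fibreI (fibreJ c) = 0 := by
  refine PiLp.ext fun k => ?_
  simp only [fibreI_apply, fibreJ_apply, partI_mulJ, PiLp.zero_apply]

theorem fibreI_add_fibreJ (v : Fibre) : fibreI v + fibreJ (fun k => coordJ (v k)) = v := by
  refine PiLp.ext fun k => ?_
  simp only [PiLp.add_apply, fibreI_apply, fibreJ_apply, partI_add_mulJ]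

/-- The character `e^{i(rm+sl)}` of the torus, where `n = (r, s)`. -/
def char (n : ℤ × ℤ) : C(Torus, ℂ) :=
  ⟨fun x => fourier n.1 x.1 * fourier n.2 x.2, by fun_prop⟩

theorem char_apply (n : ℤ × ℤ) (x : Torus) : char n x = fourier n.1 x.1 * fourier n.2 x.2 := rfl

theorem char_add (n : ℤ × ℤ) (x y : Torus) : char n (x + y) = char n x * char n y := by
  simp only [char_apply, Prod.fst_add, Prod.snd_add, fourier_apply, smul_add,
    AddCircle.toCircle_add, Circle.coe_mul]
  ring

theorem char_cover (n : ℤ × ℤ) (p : ℝ × ℝ) :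
    char n (cover p) = Complex.exp (Complex.I * (n.1 * p.1 + n.2 * p.2 : ℂ)) := by
  have hpi : (Real.pi : ℂ) ≠ 0 := Complex.ofReal_ne_zero.2 Real.pi_ne_zero
  rw [char_apply, cover, fourier_coe_apply, fourier_coe_apply, ← Complex.exp_add]
  congr 1
  push_cast
  field_simp

theorem norm_char (n : ℤ × ℤ) (x : Torus) : ‖char n x‖ = 1 := by
  rw [char_apply, norm_mul, fourier_apply, fourier_apply, Circle.norm_coe, Circle.norm_coe, one_mul]

theorem torusSmooth_char (n : ℤ × ℤ) : TorusSmooth (char n) := by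
  have h1 : ContDiff ℝ ∞ (fun p : ℝ × ℝ => (p.1 : ℂ)) := Complex.ofRealCLM.contDiff.comp contDiff_fst
  have h2 : ContDiff ℝ ∞ (fun p : ℝ × ℝ => (p.2 : ℂ)) := Complex.ofRealCLM.contDiff.comp contDiff_snd
  unfold TorusSmooth
  simp_rw [char_cover]
  exact (contDiff_const.mul ((contDiff_const.mul h1).add (contDiff_const.mul h2))).cexp

theorem dirDeriv_char (n : ℤ × ℤ) (v : ℝ × ℝ) (x : Torus) :
    dirDeriv v (char n) x = Complex.I * (n.1 * v.1 + n.2 * v.2 : ℂ) * char n x := by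
  refine dirDeriv_eq ?_
  simp_rw [char_add, char_cover]
  have h : HasDerivAt (fun t : ℝ => (t : ℂ)) 1 0 := Complex.ofRealCLM.hasDerivAt
  have h1 : HasDerivAt (fun t : ℝ => Complex.I * (n.1 * ((t * v.1 : ℝ) : ℂ)
      + n.2 * ((t * v.2 : ℝ) : ℂ))) (Complex.I * (n.1 * v.1 + n.2 * v.2 : ℂ)) 0 := by
    have h2 := h.mul_const (Complex.I * (n.1 * v.1 + n.2 * v.2 : ℂ))
    rw [one_mul] at h2
    refine h2.congr_of_eventuallyEq (Eventually.of_forall fun t => ?_)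
    push_cast
    ring
  have h3 := h1.cexp.const_mul (char n x)
  simp only [zero_mul, Complex.ofReal_zero, mul_zero, add_zero, Complex.exp_zero, one_mul] at h3
  exact h3.congr_deriv (mul_comm _ _)

/-- The form with coefficients `e^{i(rm+sl)} c₀ j, …, e^{i(rm+sl)} c₃ j`, where `n = (r, s)`. -/
def modeForm (n : ℤ × ℤ) (c : Fin 4 → ℂ) : Form := fun x => fibreJ (fun k => char n x * c k)

theorem torusSmooth_modeForm (n : ℤ × ℤ) (c : Fin 4 → ℂ) : TorusSmooth (modeForm n c) := by
  refine TorusSmooth.clm (g := fun x k => char n x * c k) ?_ fibreJ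
  exact contDiff_pi.2 fun k => ContDiff.mul (torusSmooth_char n) contDiff_const

/-- The class of `modeForm n c` in `L²`. -/
def mode (n : ℤ × ℤ) : (Fin 4 → ℂ) →ₗ[ℝ] L2Forms where
  toFun c := ContinuousMap.toLp 2 (volume : Measure Torus) ℝ
    (⟨modeForm n c, (torusSmooth_modeForm n c).continuous⟩ : C(Torus, Fibre))
  map_add' c d := by
    rw [← map_add]
    congr 1
    ext x : 1
    change fibreJ _ = fibreJ _ + fibreJ _
    rw [← map_add]
    congr 1
    funext k
    exact mul_add _ _ _
  map_smul' r c := by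
    rw [RingHom.id_apply, ← map_smul]
    congr 1
    ext x : 1
    change fibreJ _ = r • fibreJ _
    rw [← map_smul]
    congr 1
    funext k
    simp
    ring

theorem coeFn_mode (n : ℤ × ℤ) (c : Fin 4 → ℂ) : mode n c =ᵐ[volume] modeForm n c :=
  ContinuousMap.coeFn_toLp (𝕜 := ℝ) _ _

theorem coe_mul_qj (w : ℂ) : (w : ℍ[ℝ]) * qj = mulJ w := by
  have h : qj.re = 0 ∧ qj.imI = 0 ∧ qj.imJ = 1 ∧ qj.imK = 0 := ⟨rfl, rfl, rfl, rfl⟩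
  ext <;> simp [h]

theorem coe_mul_qk (w : ℂ) : (w : ℍ[ℝ]) * qk = mulJ (w * Complex.I) := by
  have h : qk.re = 0 ∧ qk.imI = 0 ∧ qk.imJ = 0 ∧ qk.imK = 1 := ⟨rfl, rfl, rfl, rfl⟩
  ext <;> simp [h]

theorem expForm_qj (r s : ℤ) (c : Fin 4 → ℂ) : expForm r s c qj ⟨rfl, rfl⟩ = mode (r, s) c := by
  unfold expForm mode
  simp only [LinearMap.coe_mk, AddHom.coe_mk]
  congr 1
  ext x : 1
  refine PiLp.ext fun k => Subtype.ext ?_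
  exact coe_mul_qj _

/-- As `k = ij`, replacing `j` by `k` amounts to one more factor `i` in front of `j`. -/
theorem expForm_qk (r s : ℤ) (c : Fin 4 → ℂ) :
    expForm r s c qk ⟨rfl, rfl⟩ = mode (r, s) (fun k => Complex.I * c k) := by
  unfold expForm mode
  simp only [LinearMap.coe_mk, AddHom.coe_mk]
  congr 1
  ext x : 1
  refine PiLp.ext fun k => Subtype.ext ?_
  refine (coe_mul_qk _).trans ?_
  change _ = ((mulJ _ : su2) : ℍ[ℝ])
  rw [char_apply, mul_assoc, mul_comm (c k)]

/-! ### The symbol of the twisted de Rham operator -/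

/-- The frequency of the mode `n`. -/
def freq (n : ℤ × ℤ) : ℂ := ⟨n.1, n.2⟩

/-- The symbol of the de Rham operator at the frequency `ξ`. -/
def symb (ξ : ℂ) (c : Fin 4 → ℂ) : Fin 4 → ℂ :=
  ![Complex.I * (ξ.re * c 2 - ξ.im * c 1), Complex.I * (ξ.im * c 0 - ξ.re * c 3),
    Complex.I * (-ξ.re * c 0 - ξ.im * c 3), Complex.I * (ξ.re * c 1 + ξ.im * c 2)]

theorem nablaM_char (z : ℂ) (n : ℤ × ℤ) (w : ℂ) (x : Torus) :
    nablaM (flatConnection z) (fun x => mulJ (char n x * w)) x =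
      mulJ (char n x * (Complex.I * ((freq n - 2 * z).re : ℂ) * w)) := by
  have h1 : partialM (fun x => mulJ (char n x * w)) x =
      mulJ (Complex.I * n.1 * char n x * w) := by
    rw [partialM_eq]
    have := dirDeriv_clm (torusSmooth_char n)
      (mulJ.comp ((ContinuousLinearMap.mul ℝ ℂ).flip w)) (1, 0) x
    simp only [dirDeriv_char] at this
    simp only [ContinuousLinearMap.comp_apply, ContinuousLinearMap.flip_apply,
      ContinuousLinearMap.mul_apply'] at this
    simpa using this
  have h2 : ∀ v, bracket (flatConnection z x).1 (mulJ v) = mulJ (-2 * Complex.I * z.re * v) := by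
    intro v
    rw [flatConnection_fst, bracket_su2Mk]
    apply su2_ext <;> simp
  rw [nablaM, h1, h2, ← map_add]
  congr 1
  simp [freq]
  ring

theorem nablaL_char (z : ℂ) (n : ℤ × ℤ) (w : ℂ) (x : Torus) :
    nablaL (flatConnection z) (fun x => mulJ (char n x * w)) x =
      mulJ (char n x * (Complex.I * ((freq n - 2 * z).im : ℂ) * w)) := by
  have h1 : partialL (fun x => mulJ (char n x * w)) x =
      mulJ (Complex.I * n.2 * char n x * w) := by
    rw [partialL_eq]
    have := dirDeriv_clm (torusSmooth_char n)
      (mulJ.comp ((ContinuousLinearMap.mul ℝ ℂ).flip w)) (0, 1) x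
    simp only [dirDeriv_char] at this
    simp only [ContinuousLinearMap.comp_apply, ContinuousLinearMap.flip_apply,
      ContinuousLinearMap.mul_apply'] at this
    simpa using this
  have h2 : ∀ v, bracket (flatConnection z x).2 (mulJ v) = mulJ (-2 * Complex.I * z.im * v) := by
    intro v
    rw [flatConnection_snd, bracket_su2Mk]
    apply su2_ext <;> simp
  rw [nablaL, h1, h2, ← map_add]
  congr 1
  simp [freq]
  ring

theorem deRham_modeForm (z : ℂ) (n : ℤ × ℤ) (c : Fin 4 → ℂ) :
    deRham (flatConnection z) (modeForm n c) = modeForm n (symb (freq n - 2 * z) c) := by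
  funext x
  have hM : ∀ k, nablaM (flatConnection z) (fun y => modeForm n c y k) x =
      mulJ (char n x * (Complex.I * ((freq n - 2 * z).re : ℂ) * c k)) :=
    fun k => nablaM_char z n (c k) x
  have hL : ∀ k, nablaL (flatConnection z) (fun y => modeForm n c y k) x =
      mulJ (char n x * (Complex.I * ((freq n - 2 * z).im : ℂ) * c k)) :=
    fun k => nablaL_char z n (c k) x
  refine PiLp.ext fun k => ?_
  rw [modeForm, fibreJ_apply]
  fin_cases k
  · refine (deRham_zero _ _ _).trans ?_
    rw [hM, hL, ← map_sub]
    congr 1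
    simp only [symb, Fin.zero_eta, Matrix.cons_val]
    ring
  · refine (deRham_one _ _ _).trans ?_
    rw [hM, hL, ← map_sub]
    congr 1
    simp only [symb, Fin.mk_one, Matrix.cons_val]
    ring
  · refine (deRham_two _ _ _).trans ?_
    rw [hM, hL, ← map_neg, ← map_sub]
    congr 1
    simp only [symb, Fin.reduceFinMk, Matrix.cons_val]
    ring
  · refine (deRham_three _ _ _).trans ?_
    rw [hM, hL, ← map_add]
    congr 1
    simp only [symb, Fin.reduceFinMk, Matrix.cons_val]
    ring

/-! ### Density of the Fourier modes -/

/-- The star subalgebra of `C(T, ℂ)` spanned by the characters. -/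
def charSubalgebra : StarSubalgebra ℂ C(Torus, ℂ) where
  toSubalgebra := Algebra.adjoin ℂ (Set.range char)
  star_mem' := by
    change Algebra.adjoin ℂ (Set.range char) ≤ star (Algebra.adjoin ℂ (Set.range char))
    refine Algebra.adjoin_le ?_
    rintro - ⟨n, rfl⟩
    refine Algebra.subset_adjoin ⟨-n, ContinuousMap.ext fun x => ?_⟩
    simp [char_apply]

theorem charSubalgebra_coe :
    Subalgebra.toSubmodule charSubalgebra.toSubalgebra = Submodule.span ℂ (Set.range char) := by
  apply Algebra.adjoin_eq_span_of_subset
  refine Set.Subset.trans ?_ Submodule.subset_span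
  intro x hx
  refine Submonoid.closure_induction (fun _ => id) ⟨0, ?_⟩ ?_ hx
  · ext1 z
    simp [char_apply]
  · rintro - - - - ⟨m, rfl⟩ ⟨n, rfl⟩
    refine ⟨m + n, ?_⟩
    ext1 z
    simp only [char_apply, Prod.fst_add, Prod.snd_add, fourier_add, ContinuousMap.mul_apply]
    ring

theorem charSubalgebra_separatesPoints : charSubalgebra.SeparatesPoints := by
  intro x y hxy
  have hpi : (2 * Real.pi) ≠ 0 := Real.two_pi_pos.ne'
  by_cases h : x.1 = y.1
  · have h2 : x.2 ≠ y.2 := fun h2 => hxy (Prod.ext h h2)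
    refine ⟨_, ⟨char (0, 1), Algebra.subset_adjoin ⟨(0, 1), rfl⟩, rfl⟩, ?_⟩
    simp only [char_apply, fourier_zero, one_mul, fourier_one]
    contrapose h2
    exact AddCircle.injective_toCircle hpi (Subtype.coe_injective h2)
  · refine ⟨_, ⟨char (1, 0), Algebra.subset_adjoin ⟨(1, 0), rfl⟩, rfl⟩, ?_⟩
    simp only [char_apply, fourier_zero, mul_one, fourier_one]
    contrapose h
    exact AddCircle.injective_toCircle hpi (Subtype.coe_injective h)

theorem span_char_closure_eq_top :
    (Submodule.span ℂ (Set.range char)).topologicalClosure = ⊤ := by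
  rw [← charSubalgebra_coe]
  exact congr_arg (Subalgebra.toSubmodule <| StarSubalgebra.toSubalgebra ·)
    (ContinuousMap.starSubalgebra_topologicalClosure_eq_top_of_separatesPoints charSubalgebra
      charSubalgebra_separatesPoints)

/-- The class of a character in `L²(T; ℂ)`. -/
def charLp (n : ℤ × ℤ) : Lp ℂ 2 (volume : Measure Torus) :=
  ContinuousMap.toLp 2 (volume : Measure Torus) ℂ (char n)

theorem span_charLp_closure_eq_top :
    (Submodule.span ℂ (Set.range charLp)).topologicalClosure = ⊤ := by
  have h := (ContinuousMap.toLp_denseRange ℂ (volume : Measure Torus) ℂ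
    (by simp : (2 : ENNReal) ≠ ⊤)).topologicalClosure_map_submodule span_char_closure_eq_top
  rw [Submodule.map_span, ContinuousLinearMap.coe_coe, ← Set.range_comp] at h
  exact h

/-- The projection of `L²` onto the forms with values in `ℝi`. -/
def projI : L2Forms →L[ℝ] L2Forms := fibreI.compLpL 2 volume

theorem coeFn_projI (ψ : L2Forms) : projI ψ =ᵐ[volume] fun x => fibreI (ψ x) :=
  ContinuousLinearMap.coeFn_compLpL _ _

theorem projI_projI (ψ : L2Forms) : projI (projI ψ) = projI ψ := by
  refine Lp.ext ?_
  filter_upwards [coeFn_projI (projI ψ), coeFn_projI ψ] with x h1 h2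
  rw [h1, h2, fibreI_fibreI]

theorem inner_projI (ψ φ : L2Forms) : inner ℝ (projI ψ) φ = inner ℝ ψ (projI φ) := by
  rw [L2.inner_def, L2.inner_def]
  refine integral_congr_ae ?_
  filter_upwards [coeFn_projI ψ, coeFn_projI φ] with x h1 h2
  rw [h1, h2, inner_fibreI]

theorem projI_mode (n : ℤ × ℤ) (c : Fin 4 → ℂ) : projI (mode n c) = 0 := by
  refine Lp.ext ?_
  filter_upwards [coeFn_projI (mode n c), coeFn_mode n c, Lp.coeFn_zero Fibre 2 (volume : Measure Torus)]
    with x h1 h2 h3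
  rw [h1, h2, h3, modeForm, fibreI_fibreJ]
  rfl

/-- The span of the forms with values in `ℝi` and of the Fourier modes with values in `ℂj`. -/
def modeSpan : Submodule ℝ L2Forms :=
  LinearMap.range projI.toLinearMap ⊔ ⨆ n, LinearMap.range (mode n)

/-- The inclusion of `L²(T; ℂ)` as the forms with only the `k`-th coefficient, in `ℂj`. -/
def singleJ (k : Fin 4) : Lp ℂ 2 (volume : Measure Torus) →L[ℝ] L2Forms :=
  (fibreJ.comp (ContinuousLinearMap.single ℝ (fun _ : Fin 4 => ℂ) k)).compLpL 2 volume

theorem singleJ_charLp (k : Fin 4) (n : ℤ × ℤ) (a : ℂ) :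
    singleJ k (a • charLp n) = mode n (Pi.single k a) := by
  refine Lp.ext ?_
  filter_upwards [ContinuousLinearMap.coeFn_compLpL (p := 2) (μ := (volume : Measure Torus))
      (fibreJ.comp (ContinuousLinearMap.single ℝ (fun _ : Fin 4 => ℂ) k)) (a • charLp n),
    coeFn_mode n (Pi.single k a), Lp.coeFn_smul a (charLp n),
    ContinuousMap.coeFn_toLp (p := 2) (𝕜 := ℂ) (volume : Measure Torus) (char n)] with x h1 h2 h3 h4
  refine h1.trans ?_
  rw [h2, h3, Pi.smul_apply, charLp, h4, modeForm, ContinuousLinearMap.comp_apply]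
  congr 1
  funext j
  by_cases hj : j = k
  · subst hj
    simp [mul_comm]
  · simp [hj]

theorem singleJ_mem (k : Fin 4) (y : Lp ℂ 2 (volume : Measure Torus)) :
    singleJ k y ∈ modeSpan.topologicalClosure := by
  -- `singleJ k` is only real linear while the span is complex, so the induction carries an
  -- arbitrary complex factor `a`.
  have hspan : ∀ y ∈ Submodule.span ℂ (Set.range charLp), ∀ a : ℂ,
      singleJ k (a • y) ∈ modeSpan.topologicalClosure := by
    intro y hy
    induction hy using Submodule.span_induction with
    | mem y hy =>
      obtain ⟨n, rfl⟩ := hy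
      intro a
      rw [singleJ_charLp]
      refine Submodule.le_topologicalClosure _ (Submodule.mem_sup_right ?_)
      exact Submodule.mem_iSup_of_mem n ⟨_, rfl⟩
    | zero =>
      intro a
      rw [smul_zero, map_zero]
      exact zero_mem _
    | add y z _ _ hy hz =>
      intro a
      rw [smul_add, map_add]
      exact add_mem (hy a) (hz a)
    | smul b y _ hy =>
      intro a
      rw [smul_smul]
      exact hy _
  have hy : y ∈ (Submodule.span ℂ (Set.range charLp)).topologicalClosure := by
    rw [span_charLp_closure_eq_top]
    trivial
  have hclosed : IsClosed {y | singleJ k y ∈ modeSpan.topologicalClosure} :=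
    (Submodule.isClosed_topologicalClosure _).preimage (singleJ k).continuous
  exact closure_minimal (fun y hy => by
    have h := hspan y hy 1
    rwa [one_smul] at h) hclosed hy

/-- The component of an `L²` form in the `k`-th coefficient, in `ℂj`. -/
def coordLp (k : Fin 4) : L2Forms →L[ℝ] Lp ℂ 2 (volume : Measure Torus) :=
  (coordJ.comp (PiLp.proj 2 (fun _ : Fin 4 => su2) k : Fibre →L[ℝ] su2)).compLpL 2 volume

theorem coeFn_singleJ_coordLp (k : Fin 4) (ψ : L2Forms) :
    singleJ k (coordLp k ψ) =ᵐ[volume] fun x => fibreJ (Pi.single k (coordJ (ψ x k))) := by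
  filter_upwards [ContinuousLinearMap.coeFn_compLpL (p := 2) (μ := (volume : Measure Torus))
      (fibreJ.comp (ContinuousLinearMap.single ℝ (fun _ : Fin 4 => ℂ) k)) (coordLp k ψ),
    ContinuousLinearMap.coeFn_compLpL (p := 2) (μ := (volume : Measure Torus))
      (coordJ.comp (PiLp.proj 2 (fun _ : Fin 4 => su2) k : Fibre →L[ℝ] su2)) ψ] with x h1 h2
  refine h1.trans ?_
  rw [coordLp, h2]
  rfl

theorem projI_add_singleJ (ψ : L2Forms) :
    projI ψ + ∑ k, singleJ k (coordLp k ψ) = ψ := by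
  refine Lp.ext ?_
  rw [Fin.sum_univ_four]
  have h5 : ∀ a b c d e : L2Forms, ⇑(a + (b + c + d + e)) =ᵐ[volume]
      fun x => a x + (b x + c x + d x + e x) := by
    intro a b c d e
    filter_upwards [Lp.coeFn_add a (b + c + d + e), Lp.coeFn_add (b + c + d) e,
      Lp.coeFn_add (b + c) d, Lp.coeFn_add b c] with x h1 h2 h3 h4
    simp only [h1, h2, h3, h4, Pi.add_apply]
  filter_upwards [h5 (projI ψ) (singleJ 0 (coordLp 0 ψ)) (singleJ 1 (coordLp 1 ψ))
    (singleJ 2 (coordLp 2 ψ)) (singleJ 3 (coordLp 3 ψ)), coeFn_projI ψ,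
    coeFn_singleJ_coordLp 0 ψ, coeFn_singleJ_coordLp 1 ψ, coeFn_singleJ_coordLp 2 ψ,
    coeFn_singleJ_coordLp 3 ψ] with x h h' h0 h1 h2 h3
  rw [h, h', h0, h1, h2, h3, ← map_add, ← map_add, ← map_add]
  refine Eq.trans ?_ (fibreI_add_fibreJ (ψ x))
  congr 2
  funext k
  fin_cases k <;> simp

theorem modeSpan_closure : modeSpan.topologicalClosure = ⊤ := by
  refine eq_top_iff.2 fun ψ _ => ?_
  rw [← projI_add_singleJ ψ]
  refine add_mem (Submodule.le_topologicalClosure _ (Submodule.mem_sup_left ⟨ψ, rfl⟩)) ?_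
  exact sum_mem fun k _ => singleJ_mem k _

/-! ### The spectral projections in terms of Fourier modes -/

theorem mem_spectralSubspace {σ : ℤˣ} {a : Form1} {μ : ℝ} {ψ : L2Forms}
    (hμ : 0 < ((σ : ℤ) : ℝ) * μ) (h : IsEigenform a μ ψ) : ψ ∈ spectralSubspace σ a :=
  Submodule.le_topologicalClosure _ (Submodule.subset_span ⟨μ, hμ, h⟩)

/-- A continuous linear map that sends a set into a closed subspace does so with its closed
span. -/
theorem map_mem_of_mem_closure_span {E F : Type*} [NormedAddCommGroup E] [NormedSpace ℝ E]
    [NormedAddCommGroup F] [NormedSpace ℝ F] (L : E →L[ℝ] F) {s : Set E}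
    {W : ClosedSubmodule ℝ F} (h : ∀ x ∈ s, L x ∈ W) {x : E}
    (hx : x ∈ (Submodule.span ℝ s).closure) : L x ∈ W := by
  have : (Submodule.span ℝ s).closure ≤ W.comap L :=
    Submodule.closure_le.2 (Submodule.span_le.2 h)
  exact this hx

theorem inner_eq_zero_of_mem_closure_span {E : Type*} [NormedAddCommGroup E]
    [InnerProductSpace ℝ E] {s : Set E} {y : E} (h : ∀ x ∈ s, inner ℝ y x = 0) {x : E}
    (hx : x ∈ (Submodule.span ℝ s).closure) : inner ℝ y x = 0 :=
  map_mem_of_mem_closure_span (innerSL ℝ y) (W := ⊥) h hx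

theorem proj_eq {E : Type*} [NormedAddCommGroup E] [InnerProductSpace ℝ E] [CompleteSpace E]
    {V : ClosedSubmodule ℝ E} {x y : E} (hy : y ∈ V) (h : ∀ v ∈ V, inner ℝ (x - y) v = 0) :
    proj V x = y :=
  Submodule.eq_starProjection_of_mem_of_inner_eq_zero hy h

theorem proj_mem {E : Type*} [NormedAddCommGroup E] [InnerProductSpace ℝ E] [CompleteSpace E]
    (V : ClosedSubmodule ℝ E) (x : E) : proj V x ∈ V :=
  Submodule.starProjection_apply_mem V.toSubmodule x

theorem inner_sub_proj {E : Type*} [NormedAddCommGroup E] [InnerProductSpace ℝ E]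
    [CompleteSpace E] {V : ClosedSubmodule ℝ E} {x v : E} (hv : v ∈ V) :
    inner ℝ (x - proj V x) v = 0 :=
  Submodule.starProjection_inner_eq_zero x v hv

/-! #### Forms with values in `ℝi` -/

theorem partI_bracket (a : ℝ) (q : su2) : partI (bracket (su2Mk a 0 0) q) = 0 := by
  rw [bracket_su2Mk]
  apply su2_ext <;> simp

theorem bracket_partI (a : ℝ) (q : su2) : bracket (su2Mk a 0 0) (partI q) = 0 := by
  rw [bracket_su2Mk]
  apply su2_ext <;> simp

theorem nablaM_partI (z w : ℂ) {f : Torus → su2} (hf : TorusSmooth f) (x : Torus) :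
    nablaM (flatConnection z) (fun x => partI (f x)) x = partI (nablaM (flatConnection w) f x) := by
  simp only [nablaM, partialM_eq, flatConnection_fst, map_add, partI_bracket, bracket_partI,
    dirDeriv_clm hf]

theorem nablaL_partI (z w : ℂ) {f : Torus → su2} (hf : TorusSmooth f) (x : Torus) :
    nablaL (flatConnection z) (fun x => partI (f x)) x = partI (nablaL (flatConnection w) f x) := by
  simp only [nablaL, partialL_eq, flatConnection_snd, map_add, partI_bracket, bracket_partI,
    dirDeriv_clm hf]

theorem deRham_fibreI (z w : ℂ) {f : Form} (hf : TorusSmooth f) :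
    deRham (flatConnection z) (fun x => fibreI (f x)) =
      fun x => fibreI (deRham (flatConnection w) f x) := by
  funext x
  have hM : ∀ k, nablaM (flatConnection z) (fun y => fibreI (f y) k) x =
      partI (nablaM (flatConnection w) (fun y => f y k) x) :=
    fun k => nablaM_partI z w (hf.coeff k) x
  have hL : ∀ k, nablaL (flatConnection z) (fun y => fibreI (f y) k) x =
      partI (nablaL (flatConnection w) (fun y => f y k) x) :=
    fun k => nablaL_partI z w (hf.coeff k) x
  refine PiLp.ext fun k => ?_
  rw [fibreI_apply]
  fin_cases k
  · refine (deRham_zero _ _ _).trans (Eq.trans ?_ (congrArg partI (deRham_zero _ _ _).symm))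
    rw [hM, hL, map_sub]
  · refine (deRham_one _ _ _).trans (Eq.trans ?_ (congrArg partI (deRham_one _ _ _).symm))
    rw [hM, hL, map_sub]
  · refine (deRham_two _ _ _).trans (Eq.trans ?_ (congrArg partI (deRham_two _ _ _).symm))
    rw [hM, hL, map_sub, map_neg]
  · refine (deRham_three _ _ _).trans (Eq.trans ?_ (congrArg partI (deRham_three _ _ _).symm))
    rw [hM, hL, map_add]

/-- `projI` intertwines the operators of any two flat connections, because the brackets drop out on
both sides. -/
theorem IsEigenform.projI {z : ℂ} {μ : ℝ} {ψ : L2Forms}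
    (h : IsEigenform (flatConnection z) μ ψ) (w : ℂ) :
    IsEigenform (flatConnection w) μ (projI ψ) := by
  obtain ⟨f, hf, hψ, hS⟩ := h
  refine ⟨fun x => fibreI (f x), TorusSmooth.clm hf fibreI, ?_, ?_⟩
  · filter_upwards [hψ, coeFn_projI ψ] with x h1 h2
    rw [h2, h1]
  · rw [deRham_fibreI w z hf, hS]
    funext x
    exact map_smul fibreI μ (f x)

theorem projI_mem_P {σ : ℤˣ} {z : ℂ} {ψ : L2Forms} (h : ψ ∈ P σ z) (w : ℂ) :
    projI ψ ∈ P σ w := by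
  refine map_mem_of_mem_closure_span projI ?_ h
  rintro ψ ⟨μ, hμ, hψ⟩
  exact mem_spectralSubspace hμ (hψ.projI w)

/-- On forms with values in `ℝi`, the spectral projection does not depend on the connection. -/
theorem proj_P_projI (σ : ℤˣ) (z : ℂ) (ψ : L2Forms) :
    proj (P σ z) (projI ψ) = projI (proj (P σ 0) (projI ψ)) := by
  refine proj_eq (projI_mem_P (proj_mem _ _) z) fun v hv => ?_
  have h : projI ψ - projI (proj (P σ 0) (projI ψ)) =
      projI (projI ψ - proj (P σ 0) (projI ψ)) := by
    rw [map_sub, projI_projI]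
  -- Self-adjointness moves `projI` onto `v`, which thereby lands in `P σ 0`, where the residue is
  -- orthogonal.
  rw [h, inner_projI]
  exact inner_sub_proj (projI_mem_P hv 0)

/-! #### Forms with values in `ℂj` -/

/-- The unit vector in the direction of `ξ`, and `0` if `ξ = 0`. -/
def dir (ξ : ℂ) : ℂ := ξ / (‖ξ‖ : ℂ)

theorem dir_zero : dir 0 = 0 := by simp [dir]

theorem norm_dir {ξ : ℂ} (h : ξ ≠ 0) : ‖dir ξ‖ = 1 := by
  simp [dir, h]

theorem norm_dir_le (ξ : ℂ) : ‖dir ξ‖ ≤ 1 := by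
  by_cases h : ξ = 0
  · simp [h, dir_zero]
  · exact (norm_dir h).le

theorem norm_mul_dir (ξ : ℂ) : (‖ξ‖ : ℂ) * dir ξ = ξ := by
  by_cases h : ξ = 0
  · simp [h]
  · rw [dir, mul_div_cancel₀]
    simpa using h

theorem dir_mul {r : ℝ} (hr : 0 < r) (ξ : ℂ) : dir (r * ξ) = dir ξ := by
  have : (r : ℂ) ≠ 0 := by exact_mod_cast hr.ne'
  rw [dir, dir, norm_mul, Complex.norm_real, Real.norm_of_nonneg hr.le, Complex.ofReal_mul,
    mul_div_mul_left _ _ this]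

theorem dir_neg (ξ : ℂ) : dir (-ξ) = -dir ξ := by
  rw [dir, dir, norm_neg, neg_div]

theorem dir_of_norm_one {ξ : ℂ} (h : ‖ξ‖ = 1) : dir ξ = ξ := by
  simp [dir, h]

theorem norm_dir_sub_dir_le {a b : ℂ} (ha : a ≠ 0) : ‖dir a - dir b‖ ≤ 2 * ‖a - b‖ / ‖a‖ := by
  have ha' : 0 < ‖a‖ := norm_pos_iff.2 ha
  rw [le_div_iff₀ ha']
  -- Both `‖a‖ * dir a = a` and `‖b‖ * dir b = b` hold also at zero, so `b = 0` needs no separate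
  -- case.
  have h : (‖a‖ : ℂ) * (dir a - dir b) = (a - b) - ((‖a‖ - ‖b‖ : ℝ) : ℂ) * dir b := by
    push_cast
    linear_combination norm_mul_dir a - norm_mul_dir b
  have h2 : ‖(‖a‖ : ℂ) * (dir a - dir b)‖ = ‖dir a - dir b‖ * ‖a‖ := by
    rw [norm_mul, Complex.norm_real, norm_norm, mul_comm]
  rw [← h2, h]
  refine (norm_sub_le _ _).trans ?_
  rw [norm_mul, Complex.norm_real, Real.norm_eq_abs]
  have h3 : |‖a‖ - ‖b‖| * ‖dir b‖ ≤ ‖a - b‖ * 1 :=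
    mul_le_mul (abs_norm_sub_norm_le a b) (norm_dir_le b) (norm_nonneg _) (norm_nonneg _)
  linarith

/-- The symbol of the spectral projection at a frequency with direction `u`. -/
def spec (σ : ℤˣ) (u : ℂ) (c : Fin 4 → ℂ) : Fin 4 → ℂ :=
  fun k => (((‖u‖ ^ 2 : ℝ) : ℂ) * c k + ((σ : ℤ) : ℂ) * symb u c k) / 2

theorem unit_mul_self (σ : ℤˣ) : ((σ : ℤ) : ℂ) * ((σ : ℤ) : ℂ) = 1 := by
  rw [← Int.cast_mul, ← Units.val_mul, Int.units_mul_self]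
  simp

theorem unit_mul_self_real (σ : ℤˣ) : ((σ : ℤ) : ℝ) * ((σ : ℤ) : ℝ) = 1 := by
  rw [← Int.cast_mul, ← Units.val_mul, Int.units_mul_self]
  simp

theorem norm_unit (σ : ℤˣ) : ‖((σ : ℤ) : ℂ)‖ = 1 := by
  rcases Int.units_eq_one_or σ with rfl | rfl <;> simp

theorem norm_sq_eq (u : ℂ) : ((‖u‖ ^ 2 : ℝ) : ℂ) = (u.re : ℂ) ^ 2 + (u.im : ℂ) ^ 2 := by
  rw [← Complex.normSq_eq_norm_sq, Complex.normSq_apply]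
  push_cast
  ring

/-! ### Algebra of the symbol and its spectral projections -/

/-- The de Rham operator squares to the Laplacian. For a unit vector `u` the symbol is thus an
involution, and `spec σ u` is its eigenprojection of sign `σ`. -/
theorem symb_symb (u : ℂ) (c : Fin 4 → ℂ) (k : Fin 4) :
    symb u (symb u c) k = ((‖u‖ ^ 2 : ℝ) : ℂ) * c k := by
  rw [norm_sq_eq]
  fin_cases k <;> simp only [symb, Fin.zero_eta, Fin.mk_one, Fin.reduceFinMk, Matrix.cons_val]
  · linear_combination (-(u.re : ℂ) ^ 2 - (u.im : ℂ) ^ 2) * c 0 * Complex.I_sq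
  · linear_combination (-(u.re : ℂ) ^ 2 - (u.im : ℂ) ^ 2) * c 1 * Complex.I_sq
  · linear_combination (-(u.re : ℂ) ^ 2 - (u.im : ℂ) ^ 2) * c 2 * Complex.I_sq
  · linear_combination (-(u.re : ℂ) ^ 2 - (u.im : ℂ) ^ 2) * c 3 * Complex.I_sq

theorem symb_add (u : ℂ) (c d : Fin 4 → ℂ) : symb u (c + d) = symb u c + symb u d := by
  funext k
  fin_cases k <;> simp [symb] <;> ring

theorem symb_smul (u a : ℂ) (c : Fin 4 → ℂ) : symb u (a • c) = a • symb u c := by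
  funext k
  fin_cases k <;> simp [symb] <;> ring

theorem symb_ofReal_mul (r : ℝ) (u : ℂ) (c : Fin 4 → ℂ) :
    symb ((r : ℂ) * u) c = (r : ℂ) • symb u c := by
  funext k
  fin_cases k <;> simp [symb] <;> ring

theorem symb_sub_left (u v : ℂ) (c : Fin 4 → ℂ) : symb (u - v) c = symb u c - symb v c := by
  funext k
  fin_cases k <;> simp [symb] <;> ring

theorem symb_eq_norm_smul (ξ : ℂ) (c : Fin 4 → ℂ) :
    symb ξ c = (‖ξ‖ : ℂ) • symb (dir ξ) c := by
  rw [← symb_ofReal_mul, norm_mul_dir]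

theorem spec_eq (σ : ℤˣ) (u : ℂ) (c : Fin 4 → ℂ) : spec σ u c =
    (1 / 2 : ℂ) • (((‖u‖ ^ 2 : ℝ) : ℂ) • c + ((σ : ℤ) : ℂ) • symb u c) := by
  funext k
  simp only [spec, Pi.smul_apply, Pi.add_apply, smul_eq_mul]
  ring

theorem spec_smul (σ : ℤˣ) (u a : ℂ) (c : Fin 4 → ℂ) : spec σ u (a • c) = a • spec σ u c := by
  rw [spec_eq, spec_eq, symb_smul]
  module

/-- This is the purpose of the factor `‖u‖ ^ 2` in `spec`, invisible for unit `u`: a mode in the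
kernel belongs to neither spectral subspace, and `dir 0 = 0` encodes that. -/
theorem spec_zero_left (σ : ℤˣ) (c : Fin 4 → ℂ) : spec σ 0 c = 0 := by
  funext k
  fin_cases k <;> simp [spec, symb]

theorem symb_spec (σ : ℤˣ) (ξ : ℂ) (c : Fin 4 → ℂ) :
    symb ξ (spec σ (dir ξ) c) = ((((σ : ℤ) : ℝ) * ‖ξ‖ : ℝ) : ℂ) • spec σ (dir ξ) c := by
  by_cases h : ξ = 0
  · funext k
    fin_cases k <;> simp [h, symb]
  have h1 : ‖dir ξ‖ = 1 := norm_dir h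
  have h2 : symb (dir ξ) (symb (dir ξ) c) = c := by
    funext k
    rw [symb_symb, h1]
    simp
  rw [symb_eq_norm_smul, spec_eq, symb_smul, symb_add, symb_smul, symb_smul, h2, h1]
  push_cast
  have := unit_mul_self σ
  match_scalars <;> first | ring1 | linear_combination (-(‖ξ‖ : ℂ) / 2) * this

theorem symb_sub_spec (σ : ℤˣ) (ξ : ℂ) (c : Fin 4 → ℂ) :
    symb ξ (c - spec σ (dir ξ) c) =
      ((-(((σ : ℤ) : ℝ) * ‖ξ‖) : ℝ) : ℂ) • (c - spec σ (dir ξ) c) := by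
  by_cases h : ξ = 0
  · funext k
    fin_cases k <;> simp [h, symb]
  have h1 : ‖dir ξ‖ = 1 := norm_dir h
  have h2 : symb (dir ξ) (symb (dir ξ) c) = c := by
    funext k
    rw [symb_symb, h1]
    simp
  have h3 : c - spec σ (dir ξ) c = (1 / 2 : ℂ) • (c + (-((σ : ℤ) : ℂ)) • symb (dir ξ) c) := by
    rw [spec_eq, h1]
    push_cast
    module
  rw [h3]
  rw [symb_eq_norm_smul, symb_smul, symb_add, symb_smul, h2]
  push_cast
  have := unit_mul_self σ
  match_scalars <;> first | ring1 | linear_combination (-(‖ξ‖ : ℂ) / 2) * this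

theorem isEigenform_mode {z : ℂ} {n : ℤ × ℤ} {c : Fin 4 → ℂ} {μ : ℝ}
    (h : symb (freq n - 2 * z) c = (μ : ℂ) • c) :
    IsEigenform (flatConnection z) μ (mode n c) := by
  refine ⟨modeForm n c, torusSmooth_modeForm n c, coeFn_mode n c, ?_⟩
  rw [deRham_modeForm, h]
  funext x
  change fibreJ _ = μ • fibreJ _
  rw [← map_smul]
  congr 1
  funext k
  simp
  ring

/-- On Fourier modes with values in `ℂj`, the spectral projection acts through its symbol. -/
theorem proj_P_mode (σ : ℤˣ) (z : ℂ) (n : ℤ × ℤ) (c : Fin 4 → ℂ) :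
    proj (P σ z) (mode n c) = mode n (spec σ (dir (freq n - 2 * z)) c) := by
  have hpos := isEigenform_mode (symb_spec σ (freq n - 2 * z) c)
  have hneg := isEigenform_mode (symb_sub_spec σ (freq n - 2 * z) c)
  rw [map_sub] at hneg
  refine proj_eq ?_ fun v hv => ?_
  · by_cases h : freq n - 2 * z = 0
    · rw [h, dir_zero, spec_zero_left, map_zero]
      exact zero_mem _
    · refine mem_spectralSubspace ?_ hpos
      rw [← mul_assoc, unit_mul_self_real, one_mul]
      exact norm_pos_iff.2 h
  -- The remainder is an eigenform for `-σ‖ξ‖`, whose sign is opposite to `σ` or zero, so it is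
  -- orthogonal to every generator of `P σ z`; this includes `ξ = 0`.
  · refine inner_eq_zero_of_mem_closure_span ?_ hv
    rintro v ⟨μ, hμ, hv⟩
    refine hneg.inner_eq_zero hv fun h => ?_
    rw [← h, mul_neg, ← mul_assoc, unit_mul_self_real, one_mul] at hμ
    exact absurd (norm_nonneg (freq n - 2 * z)) (by linarith)

/-- Any unit vector `u` is the direction of the mode `n` for a suitable auxiliary connection, so the
orthogonality is that of a spectral projection there. -/
theorem inner_mode_spec (σ : ℤˣ) {u : ℂ} (hu : ‖u‖ = 1) (n : ℤ × ℤ) (c d : Fin 4 → ℂ) :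
    inner ℝ (mode n c - mode n (spec σ u c)) (mode n (spec σ u d)) = 0 := by
  have hz : freq n - 2 * ((freq n - u) / 2) = u := by ring
  have h : proj (P σ ((freq n - u) / 2)) (mode n c) = mode n (spec σ u c) := by
    rw [proj_P_mode, hz, dir_of_norm_one hu]
  have h' : proj (P σ ((freq n - u) / 2)) (mode n d) = mode n (spec σ u d) := by
    rw [proj_P_mode, hz, dir_of_norm_one hu]
  rw [← h, ← h']
  exact inner_sub_proj (proj_mem _ _)

/-! ### Orthogonality of distinct modes -/

theorem freq_injective : Function.Injective freq := by
  intro m n h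
  have h1 : ((m.1 : ℤ) : ℝ) = n.1 := congrArg Complex.re h
  have h2 : ((m.2 : ℤ) : ℝ) = n.2 := congrArg Complex.im h
  exact Prod.ext (by exact_mod_cast h1) (by exact_mod_cast h2)

/-- For the connection with `z = freq m / 2` the mode `m` lies in the kernel, while the mode `n` is
a sum of eigenforms with nonzero eigenvalues. No integral has to be computed. -/
theorem inner_mode_mode {m n : ℤ × ℤ} (h : m ≠ n) (c d : Fin 4 → ℂ) :
    inner ℝ (mode m c) (mode n d) = 0 := by
  have hz : freq m - 2 * (freq m / 2) = 0 := by ring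
  have hξ : freq n - 2 * (freq m / 2) ≠ 0 := by
    intro h'
    refine h (freq_injective ?_)
    linear_combination -h'
  have h0 : IsEigenform (flatConnection (freq m / 2)) 0 (mode m c) := by
    refine isEigenform_mode ?_
    rw [hz]
    funext k
    fin_cases k <;> simp [symb]
  have h1 := isEigenform_mode (symb_spec 1 (freq n - 2 * (freq m / 2)) d)
  have h2 := isEigenform_mode (symb_sub_spec 1 (freq n - 2 * (freq m / 2)) d)
  have e1 := h0.inner_eq_zero h1 (by simpa using (norm_ne_zero_iff.2 hξ).symm)
  have e2 := h0.inner_eq_zero h2 (by simpa using hξ)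
  rw [map_sub, inner_sub_right, e1, sub_zero] at e2
  exact e2

/-! ### Subspaces given by Fourier multipliers -/

theorem norm_mulJ (w : ℂ) : ‖mulJ w‖ = ‖w‖ := by
  have h : ‖mulJ w‖ ^ 2 = ‖w‖ ^ 2 := by
    rw [← real_inner_self_eq_norm_sq, inner_mulJ, ← Complex.normSq_eq_norm_sq, Complex.normSq_apply]
  exact (sq_eq_sq₀ (norm_nonneg _) (norm_nonneg _)).1 h

theorem norm_le_norm_fibreJ (c : Fin 4 → ℂ) (k : Fin 4) : ‖c k‖ ≤ ‖fibreJ c‖ := by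
  rw [← norm_mulJ, ← fibreJ_apply]
  exact PiLp.norm_apply_le _ _

theorem norm_fibreJ_le {c : Fin 4 → ℂ} {M : ℝ} (h : ∀ k, ‖c k‖ ≤ M) : ‖fibreJ c‖ ≤ 2 * M := by
  have hM : 0 ≤ M := (norm_nonneg _).trans (h 0)
  refine le_of_sq_le_sq ?_ (by positivity)
  rw [PiLp.norm_sq_eq_of_L2, Fin.sum_univ_four]
  simp only [fibreJ_apply, norm_mulJ]
  have := fun k => pow_le_pow_left₀ (norm_nonneg (c k)) (h k) 2
  nlinarith [this 0, this 1, this 2, this 3]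

theorem norm_symb_le (u : ℂ) {c : Fin 4 → ℂ} {N : ℝ} (h : ∀ k, ‖c k‖ ≤ N) (k : Fin 4) :
    ‖symb u c k‖ ≤ 2 * ‖u‖ * N := by
  have key : ∀ (a b : ℝ) (i j : Fin 4), |a| ≤ ‖u‖ → |b| ≤ ‖u‖ →
      ‖Complex.I * ((a : ℂ) * c i + (b : ℂ) * c j)‖ ≤ 2 * ‖u‖ * N := by
    intro a b i j ha hb
    rw [norm_mul, Complex.norm_I, one_mul]
    refine (norm_add_le _ _).trans ?_
    rw [norm_mul, norm_mul, Complex.norm_real, Complex.norm_real, Real.norm_eq_abs,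
      Real.norm_eq_abs]
    have h1 := mul_le_mul ha (h i) (norm_nonneg _) (norm_nonneg _)
    have h2 := mul_le_mul hb (h j) (norm_nonneg _) (norm_nonneg _)
    linarith
  have hre := Complex.abs_re_le_norm u
  have him := Complex.abs_im_le_norm u
  fin_cases k
  · simpa [symb, sub_eq_add_neg] using key u.re (-u.im) 2 1 hre (by rwa [abs_neg])
  · simpa [symb, sub_eq_add_neg] using key u.im (-u.re) 0 3 him (by rwa [abs_neg])
  · simpa [symb, sub_eq_add_neg] using
      key (-u.re) (-u.im) 0 3 (by rwa [abs_neg]) (by rwa [abs_neg])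
  · simpa [symb, sub_eq_add_neg] using key u.re u.im 1 2 hre him

/-- In each coefficient the quadratic term and the symbol contribute `2‖u - v‖` each, halved by the
definition of `spec`; passing from the four coefficients to the Euclidean norm costs another factor
`2`. -/
theorem norm_spec_sub_le (σ : ℤˣ) {u v : ℂ} (hu : ‖u‖ ≤ 1) (hv : ‖v‖ ≤ 1) (c : Fin 4 → ℂ) :
    ‖fibreJ (spec σ u c - spec σ v c)‖ ≤ 4 * ‖u - v‖ * ‖fibreJ c‖ := by
  have h : ∀ k, ‖(spec σ u c - spec σ v c) k‖ ≤ 2 * ‖u - v‖ * ‖fibreJ c‖ := by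
    intro k
    have e : (spec σ u c - spec σ v c) k = (((‖u‖ ^ 2 - ‖v‖ ^ 2 : ℝ) : ℂ) * c k +
        ((σ : ℤ) : ℂ) * symb (u - v) c k) / 2 := by
      rw [symb_sub_left]
      simp only [Pi.sub_apply, spec]
      push_cast
      ring
    rw [e, norm_div, Complex.norm_ofNat]
    have h1 : ‖((‖u‖ ^ 2 - ‖v‖ ^ 2 : ℝ) : ℂ) * c k‖ ≤ (2 * ‖u - v‖) * ‖fibreJ c‖ := by
      rw [norm_mul, Complex.norm_real, Real.norm_eq_abs]
      refine mul_le_mul ?_ (norm_le_norm_fibreJ c k) (norm_nonneg _) (by positivity)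
      rw [sq_sub_sq, abs_mul, abs_of_nonneg (by positivity)]
      exact mul_le_mul (by linarith) (abs_norm_sub_norm_le u v) (abs_nonneg _) (by norm_num)
    have h2 : ‖((σ : ℤ) : ℂ) * symb (u - v) c k‖ ≤ 2 * ‖u - v‖ * ‖fibreJ c‖ := by
      rw [norm_mul, norm_unit, one_mul]
      exact norm_symb_le _ (norm_le_norm_fibreJ c) k
    have h3 := (norm_add_le (((‖u‖ ^ 2 - ‖v‖ ^ 2 : ℝ) : ℂ) * c k)
      (((σ : ℤ) : ℂ) * symb (u - v) c k)).trans (add_le_add h1 h2)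
    linarith
  calc _ ≤ 2 * (2 * ‖u - v‖ * ‖fibreJ c‖) := norm_fibreJ_le h
    _ = _ := by ring

/-- `spec` is complex linear and so commutes with the scalar `char n x`; the estimate holds
pointwise on the torus. -/
theorem norm_mode_spec_sub_le (σ : ℤˣ) {u v : ℂ} (hu : ‖u‖ ≤ 1) (hv : ‖v‖ ≤ 1) (n : ℤ × ℤ)
    (c : Fin 4 → ℂ) :
    ‖mode n (spec σ u c - spec σ v c)‖ ≤ 4 * ‖u - v‖ * ‖mode n c‖ := by
  refine Lp.norm_le_mul_norm_of_ae_le_mul ?_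
  filter_upwards [coeFn_mode n (spec σ u c - spec σ v c), coeFn_mode n c] with x h1 h2
  rw [h1, h2]
  have e : modeForm n (spec σ u c - spec σ v c) x =
      fibreJ (spec σ u (char n x • c) - spec σ v (char n x • c)) := by
    rw [spec_smul, spec_smul, ← smul_sub]
    rfl
  rw [e]
  exact norm_spec_sub_le σ hu hv _

theorem norm_sum_sq_of_orthogonal {ι E : Type*} [NormedAddCommGroup E] [InnerProductSpace ℝ E]
    (s : Finset ι) (f : ι → E) (h : ∀ i j, i ≠ j → inner ℝ (f i) (f j) = 0) :
    ‖∑ i ∈ s, f i‖ ^ 2 = ∑ i ∈ s, ‖f i‖ ^ 2 := by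
  rw [← real_inner_self_eq_norm_sq, sum_inner]
  refine Finset.sum_congr rfl fun i hi => ?_
  rw [inner_sum, Finset.sum_eq_single_of_mem i hi fun j _ hj => h i j hj.symm,
    real_inner_self_eq_norm_sq]

/-- An operator that vanishes on the forms with values in `ℝi` and preserves the Fourier modes with
values in `ℂj` is bounded by its bound on the individual modes. -/
theorem opNorm_le_of_mode {D : L2Forms →L[ℝ] L2Forms} {C : ℝ} (hC : 0 ≤ C)
    (hI : ∀ ψ, D (projI ψ) = 0)
    (hJ : ∀ n c, ∃ d, D (mode n c) = mode n d ∧ ‖mode n d‖ ≤ C * ‖mode n c‖) : ‖D‖ ≤ C := by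
  refine D.opNorm_le_bound hC fun ψ => ?_
  have hclosed : IsClosed {ψ | ‖D ψ‖ ≤ C * ‖ψ‖} :=
    isClosed_le D.continuous.norm (continuous_const.mul continuous_norm)
  have hmem : ψ ∈ modeSpan.topologicalClosure := by
    rw [modeSpan_closure]
    trivial
  refine closure_minimal (fun ψ hψ => ?_) hclosed hmem
  obtain ⟨_, ⟨φ, rfl⟩, χ, hχ, rfl⟩ := Submodule.mem_sup.1 hψ
  obtain ⟨f, hf, rfl⟩ := (Submodule.mem_iSup_iff_exists_finsupp _ _).1 hχ
  choose c hc using hf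
  choose d hd hdle using hJ
  have hsum : f.sum (fun _ x => x) = ∑ n ∈ f.support, mode n (c n) :=
    Finset.sum_congr rfl fun n _ => (hc n).symm
  change ‖D (projI φ + f.sum fun _ x => x)‖ ≤ C * ‖projI φ + f.sum fun _ x => x‖
  rw [hsum, map_add, hI, zero_add, map_sum]
  have h1 : ‖∑ n ∈ f.support, D (mode n (c n))‖ ^ 2 ≤ (C * ‖∑ n ∈ f.support, mode n (c n)‖) ^ 2 := by
    simp_rw [hd]
    rw [mul_pow, norm_sum_sq_of_orthogonal _ _ fun i j h => inner_mode_mode h _ _,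
      norm_sum_sq_of_orthogonal _ _ fun i j h => inner_mode_mode h _ _, Finset.mul_sum]
    refine Finset.sum_le_sum fun n _ => ?_
    rw [← mul_pow]
    exact pow_le_pow_left₀ (norm_nonneg _) (hdle n (c n)) 2
  -- The `ℝi`-valued part is orthogonal to the modes, so dropping it can only decrease the norm.
  have h2 : ‖∑ n ∈ f.support, mode n (c n)‖ ^ 2 ≤
      ‖projI φ + ∑ n ∈ f.support, mode n (c n)‖ ^ 2 := by
    have h0 : inner ℝ (projI φ) (∑ n ∈ f.support, mode n (c n)) = 0 := by
      rw [inner_projI, map_sum]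
      simp [projI_mode]
    rw [norm_add_sq_real, h0]
    nlinarith [sq_nonneg ‖projI φ‖]
  have h3 := (sq_le_sq₀ (norm_nonneg _) (by positivity)).1 h1
  have h4 := (sq_le_sq₀ (norm_nonneg _) (norm_nonneg _)).1 h2
  exact h3.trans (mul_le_mul_of_nonneg_left h4 hC)

/-- The orthogonal projection onto `V` is given by the standard spectral projection on the forms
with values in `ℝi`, and by the symbols `spec σ (u n)` on those with values in `ℂj`. -/
structure IsMultiplier (σ : ℤˣ) (V : ClosedSubmodule ℝ L2Forms) (u : ℤ × ℤ → ℂ) : Prop where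
  norm_le : ∀ n, ‖u n‖ ≤ 1
  proj_projI : ∀ ψ, proj V (projI ψ) = projI (proj (P σ 0) (projI ψ))
  proj_mode : ∀ n c, proj V (mode n c) = mode n (spec σ (u n) c)

theorem IsMultiplier.norm_sub_le {σ : ℤˣ} {V W : ClosedSubmodule ℝ L2Forms} {u v : ℤ × ℤ → ℂ}
    (hV : IsMultiplier σ V u) (hW : IsMultiplier σ W v) {ε : ℝ} (hε : 0 ≤ ε)
    (h : ∀ n, ‖u n - v n‖ ≤ ε) : ‖proj V - proj W‖ ≤ 4 * ε := by
  refine opNorm_le_of_mode (by positivity) (fun ψ => ?_) fun n c => ?_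
  · rw [_root_.sub_apply, hV.proj_projI, hW.proj_projI, sub_self]
  · refine ⟨spec σ (u n) c - spec σ (v n) c, ?_, ?_⟩
    · rw [_root_.sub_apply, hV.proj_mode, hW.proj_mode, map_sub]
    · refine (norm_mode_spec_sub_le σ (hV.norm_le n) (hW.norm_le n) n c).trans ?_
      have := h n
      gcongr

theorem tendsto_of_isMultiplier {σ : ℤˣ} {X : Type*} {l : Filter X}
    {V : X → ClosedSubmodule ℝ L2Forms} {u : X → ℤ × ℤ → ℂ} {W : ClosedSubmodule ℝ L2Forms}
    {v : ℤ × ℤ → ℂ} (hV : ∀ x, IsMultiplier σ (V x) (u x)) (hW : IsMultiplier σ W v)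
    (h : ∀ ε > 0, ∀ᶠ x in l, ∀ n, ‖u x n - v n‖ ≤ ε) : Tendsto V l (𝓝 W) := by
  rw [nhds_induced, tendsto_comap_iff, Metric.tendsto_nhds]
  intro ε hε
  filter_upwards [h (ε / 8) (by positivity)] with x hx
  rw [dist_eq_norm]
  have := (hV x).norm_sub_le hW (by positivity) hx
  refine this.trans_lt ?_
  linarith

/-- The space spanned by the limits in direction `θ` of the eigenforms with small eigenvalue. -/
def limitKernel (σ : ℤˣ) (z : ℂ) (θ : Circle) : ClosedSubmodule ℝ L2Forms :=
  (Submodule.span ℝ {ψ : L2Forms | ∃ n c, freq n = 2 * z ∧ mode n (spec σ (-θ) c) = ψ}).closure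

/-- The directions of the frequencies, where the zero frequency is assigned the direction `-θ`. -/
def blowUpDir (z : ℂ) (θ : Circle) (n : ℤ × ℤ) : ℂ :=
  if freq n = 2 * z then -θ else dir (freq n - 2 * z)

/-! ### The multiplier of `P ⊔ limitKernel` -/

theorem inner_projI_limitKernel {σ : ℤˣ} {z : ℂ} {θ : Circle} {φ v : L2Forms}
    (hv : v ∈ limitKernel σ z θ) : inner ℝ (projI φ) v = 0 := by
  refine inner_eq_zero_of_mem_closure_span ?_ hv
  rintro v ⟨n, c, -, rfl⟩
  rw [inner_projI, projI_mode, inner_zero_right]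

theorem inner_limitKernel_P {σ : ℤˣ} {z : ℂ} {θ : Circle} {φ v : L2Forms}
    (hφ : φ ∈ limitKernel σ z θ) (hv : v ∈ P σ z) : inner ℝ φ v = 0 := by
  rw [real_inner_comm]
  refine inner_eq_zero_of_mem_closure_span ?_ hφ
  rintro φ ⟨n, c, hn, rfl⟩
  have h : proj (P σ z) (mode n (spec σ (-θ) c)) = 0 := by
    rw [proj_P_mode, hn, sub_self, dir_zero, spec_zero_left, map_zero]
  have h2 := inner_sub_proj (x := mode n (spec σ (-θ) c)) hv
  rwa [h, sub_zero, real_inner_comm] at h2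

/-- The supremum of closed subspaces is a closure, but the kernel of `inner ℝ y` is itself a closed
subspace containing both. -/
theorem inner_eq_zero_of_mem_sup {E : Type*} [NormedAddCommGroup E] [InnerProductSpace ℝ E]
    {V W : ClosedSubmodule ℝ E} {y : E} (hV : ∀ v ∈ V, inner ℝ y v = 0)
    (hW : ∀ v ∈ W, inner ℝ y v = 0) {v : E} (hv : v ∈ V ⊔ W) : inner ℝ y v = 0 := by
  have : V ⊔ W ≤ (⊥ : ClosedSubmodule ℝ ℝ).comap (innerSL ℝ y) := sup_le hV hW
  exact this hv

theorem norm_neg_circle (θ : Circle) : ‖-(θ : ℂ)‖ = 1 := by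
  rw [norm_neg, Circle.norm_coe]

/-- `limitKernel` is orthogonal to `P σ z` and lives only in the zero-frequency mode; adding it
changes the projection there, from `0` to `spec σ (-θ)`, and nowhere else. -/
theorem isMultiplier_sup_limitKernel (σ : ℤˣ) (z : ℂ) (θ : Circle) :
    IsMultiplier σ (P σ z ⊔ limitKernel σ z θ) (blowUpDir z θ) := by
  have hl : P σ z ≤ P σ z ⊔ limitKernel σ z θ := le_sup_left
  have hr : limitKernel σ z θ ≤ P σ z ⊔ limitKernel σ z θ := le_sup_right
  refine ⟨fun n => ?_, fun ψ => ?_, fun n c => ?_⟩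
  · unfold blowUpDir
    split_ifs
    · exact (norm_neg_circle θ).le
    · exact norm_dir_le _
  · rw [← proj_P_projI σ z ψ]
    refine proj_eq (hl (proj_mem _ _)) fun v hv => ?_
    refine inner_eq_zero_of_mem_sup (fun v hv => inner_sub_proj hv) (fun v hv => ?_) hv
    rw [proj_P_projI σ z ψ, ← map_sub]
    exact inner_projI_limitKernel hv
  · by_cases hn : freq n = 2 * z
    · have hP : proj (P σ z) (mode n c) = 0 := by
        rw [proj_P_mode, hn, sub_self, dir_zero, spec_zero_left, map_zero]
      have hK : mode n (spec σ (-θ) c) ∈ limitKernel σ z θ :=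
        Submodule.le_topologicalClosure _ (Submodule.subset_span ⟨n, c, hn, rfl⟩)
      rw [blowUpDir, if_pos hn]
      refine proj_eq (hr hK) fun v hv => ?_
      refine inner_eq_zero_of_mem_sup (fun v hv => ?_) (fun v hv => ?_) hv
      · have h := inner_sub_proj (x := mode n c) hv
        rw [hP, sub_zero] at h
        rw [inner_sub_left, h, inner_limitKernel_P hK hv, sub_zero]
      · refine inner_eq_zero_of_mem_closure_span ?_ hv
        rintro v ⟨m, d, hm, rfl⟩
        obtain rfl : m = n := freq_injective (hm.trans hn.symm)
        exact inner_mode_spec σ (norm_neg_circle θ) m c d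
    · rw [blowUpDir, if_neg hn, ← proj_P_mode]
      refine proj_eq (hl (proj_mem _ _)) fun v hv => ?_
      refine inner_eq_zero_of_mem_sup (fun v hv => inner_sub_proj hv) (fun v hv => ?_) hv
      rw [proj_P_mode, ← map_sub]
      refine inner_eq_zero_of_mem_closure_span ?_ hv
      rintro v ⟨m, d, hm, rfl⟩
      refine inner_mode_mode ?_ _ _
      rintro rfl
      exact hn hm

/-! ### The half-integer lattice -/

theorem mem_halfLattice_iff {z : ℂ} : z ∈ halfLattice ↔ ∃ n, freq n = 2 * z := by
  constructor
  · rintro ⟨r, s, rfl⟩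
    refine ⟨(r, s), ?_⟩
    apply Complex.ext <;> simp [freq] <;> ring
  · rintro ⟨n, hn⟩
    refine ⟨n.1, n.2, ?_⟩
    have h1 := congrArg Complex.re hn
    have h2 := congrArg Complex.im hn
    simp only [freq, Complex.mul_re, Complex.mul_im, Complex.re_ofNat, Complex.im_ofNat] at h1 h2
    apply Complex.ext <;> simp <;> linarith

theorem one_le_norm_freq_sub {m n : ℤ × ℤ} (h : m ≠ n) : 1 ≤ ‖freq m - freq n‖ := by
  have key : ∀ a b : ℤ, a ≠ b → (1 : ℝ) ≤ |(a : ℝ) - b| := by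
    intro a b hab
    exact_mod_cast Int.one_le_abs (sub_ne_zero.2 hab)
  by_cases h1 : m.1 = n.1
  · have h2 : m.2 ≠ n.2 := fun h2 => h (Prod.ext h1 h2)
    exact (key _ _ h2).trans (by simpa [freq] using Complex.abs_im_le_norm (freq m - freq n))
  · exact (key _ _ h1).trans (by simpa [freq] using Complex.abs_re_le_norm (freq m - freq n))

theorem nearest_mem (z : ℂ) : nearest z ∈ halfLattice := ⟨_, _, rfl⟩

/-- Rounding minimises each coordinate separately, so `nearest` realises the distance to the
lattice. -/
theorem norm_sub_nearest_le {z p : ℂ} (hp : p ∈ halfLattice) : ‖z - nearest z‖ ≤ ‖z - p‖ := by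
  obtain ⟨r, s, rfl⟩ := hp
  have key : ∀ (x : ℝ) (r : ℤ), (x - (round (2 * x) : ℝ) / 2) ^ 2 ≤ (x - (r : ℝ) / 2) ^ 2 := by
    intro x r
    have h := round_le (2 * x) r
    have h2 := sq_le_sq.2 h
    nlinarith
  refine le_of_sq_le_sq ?_ (norm_nonneg _)
  rw [← Complex.normSq_eq_norm_sq, ← Complex.normSq_eq_norm_sq, Complex.normSq_apply,
    Complex.normSq_apply]
  have h1 := key z.re r
  have h2 := key z.im s
  simp only [nearest, Complex.sub_re, Complex.sub_im]
  nlinarith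

theorem halfLattice_eq {p q : ℂ} (hp : p ∈ halfLattice) (hq : q ∈ halfLattice)
    (h : ‖p - q‖ < 1 / 2) : p = q := by
  obtain ⟨m, hm⟩ := mem_halfLattice_iff.1 hp
  obtain ⟨n, hn⟩ := mem_halfLattice_iff.1 hq
  by_contra hpq
  have hmn : m ≠ n := by
    rintro rfl
    exact hpq (mul_left_cancel₀ two_ne_zero (hm.symm.trans hn))
  have h1 := one_le_norm_freq_sub hmn
  rw [hm, hn, ← mul_sub, norm_mul, Complex.norm_ofNat] at h1
  linarith

theorem nearest_eq {z p : ℂ} (hp : p ∈ halfLattice) (h : ‖z - p‖ < 1 / 4) : nearest z = p := by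
  refine halfLattice_eq (nearest_mem z) hp ?_
  have h1 := norm_sub_nearest_le (z := z) hp
  have h2 : nearest z - p = (z - p) - (z - nearest z) := by ring
  rw [h2]
  exact (norm_sub_le _ _).trans_lt (by linarith)

/-- The nonzero frequencies are bounded away from zero. -/
theorem exists_pos_le_norm_freq_sub (z : ℂ) :
    ∃ δ > 0, ∀ n, freq n ≠ 2 * z → δ ≤ ‖freq n - 2 * z‖ := by
  by_cases hz : z ∈ halfLattice
  · obtain ⟨m, hm⟩ := mem_halfLattice_iff.1 hz
    -- Here `2 * z` is itself an integer frequency, and distinct ones are at least `1` apart.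
    refine ⟨1, one_pos, fun n hn => ?_⟩
    rw [← hm] at hn ⊢
    exact one_le_norm_freq_sub fun h => hn (congrArg freq h)
  · have hpos : 0 < ‖z - nearest z‖ := by
      refine norm_pos_iff.2 fun h => hz ?_
      rw [sub_eq_zero.1 h]
      exact nearest_mem z
    refine ⟨2 * ‖z - nearest z‖, by positivity, fun n _ => ?_⟩
    have h1 := norm_sub_nearest_le (z := z) (mem_halfLattice_iff.2 ⟨n, (by ring : freq n = 2 * (freq n / 2))⟩)
    have h2 : freq n - 2 * z = -2 * (z - freq n / 2) := by ring
    rw [h2, norm_mul, norm_neg, Complex.norm_ofNat]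
    linarith

/-! ### Continuity of the spectral subspaces -/

theorem limitKernel_eq_bot {σ : ℤˣ} {z : ℂ} (hz : z ∉ halfLattice) (θ : Circle) :
    limitKernel σ z θ = ⊥ := by
  refine le_antisymm (Submodule.closure_le.2 (Submodule.span_le.2 ?_)) bot_le
  rintro ψ ⟨n, c, hn, -⟩
  exact absurd (mem_halfLattice_iff.2 ⟨n, hn⟩) hz

theorem sup_limitKernel_of_notMem {σ : ℤˣ} {z : ℂ} (hz : z ∉ halfLattice) (θ : Circle) :
    P σ z ⊔ limitKernel σ z θ = P σ z := by
  rw [limitKernel_eq_bot hz, sup_bot_eq]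

/-- Continuity of `P ⊔ limitKernel` only has to be checked at the zero frequency. -/
theorem tendsto_sup_limitKernel (σ : ℤˣ) {X : Type*} {l : Filter X} {z : X → ℂ} {θ : X → Circle}
    {z₀ : ℂ} {θ₀ : Circle} (hz : Tendsto z l (𝓝 z₀))
    (h : ∀ n, freq n = 2 * z₀ → Tendsto (fun x => blowUpDir (z x) (θ x) n) l (𝓝 (-θ₀))) :
    Tendsto (fun x => P σ (z x) ⊔ limitKernel σ (z x) (θ x)) l
      (𝓝 (P σ z₀ ⊔ limitKernel σ z₀ θ₀)) := by
  refine tendsto_of_isMultiplier (fun x => isMultiplier_sup_limitKernel σ (z x) (θ x))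
    (isMultiplier_sup_limitKernel σ z₀ θ₀) fun ε hε => ?_
  obtain ⟨δ, hδ, hδ'⟩ := exists_pos_le_norm_freq_sub z₀
  have hfar : ∀ᶠ x in l, ∀ n, freq n ≠ 2 * z₀ →
      ‖blowUpDir (z x) (θ x) n - blowUpDir z₀ θ₀ n‖ ≤ ε := by
    -- The bound `δ / 2` keeps the frequencies that are nonzero at `z₀` nonzero at `z x`; the bound
    -- `ε * δ / 4` offsets the factor `4 / δ` in the estimate for directions.
    have hr : 0 < min (δ / 2) (ε * δ / 4) := by positivity
    filter_upwards [Metric.tendsto_nhds.1 hz _ hr] with x hx n hn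
    rw [dist_eq_norm, lt_min_iff] at hx
    have e : (freq n - 2 * z₀) - (freq n - 2 * z x) = 2 * (z x - z₀) := by ring
    have hne : freq n ≠ 2 * z x := by
      intro h0
      have h1 := hδ' n hn
      rw [h0, sub_self, sub_zero] at e
      rw [h0, e, norm_mul, Complex.norm_ofNat] at h1
      linarith [hx.1]
    rw [blowUpDir, blowUpDir, if_neg hn, if_neg hne, norm_sub_rev]
    refine (norm_dir_sub_dir_le (sub_ne_zero.2 hn)).trans ?_
    rw [e, norm_mul, Complex.norm_ofNat, div_le_iff₀ (hδ.trans_le (hδ' n hn))]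
    have h2 := mul_le_mul_of_nonneg_left (hδ' n hn) hε.le
    linarith [hx.2]
  by_cases hz₀ : z₀ ∈ halfLattice
  · obtain ⟨m, hm⟩ := mem_halfLattice_iff.1 hz₀
    filter_upwards [hfar, Metric.tendsto_nhds.1 (h m hm) ε hε] with x hx hxm n
    by_cases hn : freq n = 2 * z₀
    · obtain rfl : n = m := freq_injective (hn.trans hm.symm)
      rw [dist_eq_norm] at hxm
      have : blowUpDir z₀ θ₀ n = -θ₀ := if_pos hn
      rw [this]
      exact hxm.le
    · exact hx n hn
  · filter_upwards [hfar] with x hx n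
    exact hx n fun hn => hz₀ (mem_halfLattice_iff.2 ⟨n, hn⟩)

theorem continuousOn_P (σ : ℤˣ) : ContinuousOn (P σ) halfLatticeᶜ := by
  -- The angle `1` is arbitrary: off the lattice `limitKernel` is trivial.
  refine fun z hz => tendsto_nhdsWithin_congr (f := fun w => P σ w ⊔ limitKernel σ w 1)
    (fun w hw => sup_limitKernel_of_notMem hw 1) ?_
  rw [← sup_limitKernel_of_notMem (σ := σ) hz 1]
  refine tendsto_sup_limitKernel σ (tendsto_id.mono_left nhdsWithin_le_nhds) fun n hn => ?_
  exact absurd (mem_halfLattice_iff.2 ⟨n, hn⟩) hz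

theorem tendsto_P_ray (σ : ℤˣ) (z : ℂ) (θ : Circle) :
    Tendsto (fun t : ℝ => P σ (z + (t : ℂ) * (θ : ℂ))) (𝓝[>] 0)
      (𝓝 (P σ z ⊔ limitKernel σ z θ)) := by
  have hz : Tendsto (fun t : ℝ => z + (t : ℂ) * (θ : ℂ)) (𝓝[>] 0) (𝓝 z) := by
    have : Continuous (fun t : ℝ => z + (t : ℂ) * (θ : ℂ)) := by fun_prop
    have h := this.tendsto 0
    simp only [Complex.ofReal_zero, zero_mul, add_zero] at h
    exact h.mono_left nhdsWithin_le_nhds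
  -- The frequency that vanishes at `z` is `-2tθ` along the ray, so its direction is exactly `-θ`,
  -- not only in the limit.
  have hdir : ∀ n, freq n = 2 * z → ∀ t : ℝ, 0 < t →
      blowUpDir (z + (t : ℂ) * (θ : ℂ)) θ n = -θ := by
    intro n hn t ht
    unfold blowUpDir
    split_ifs with h
    · rfl
    · have e : freq n - 2 * (z + (t : ℂ) * (θ : ℂ)) = ((2 * t : ℝ) : ℂ) * (-θ) := by
        rw [hn]
        push_cast
        ring
      rw [e, dir_mul (by positivity), dir_of_norm_one (norm_neg_circle θ)]
  obtain ⟨δ, hδ, hδ'⟩ := exists_pos_le_norm_freq_sub z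
  -- A lattice point at parameter `t` would give an integer frequency at distance `2t < δ` from `2 *
  -- z`. Off the lattice the extra summand disappears and only `P` remains.
  have hoff : ∀ᶠ t : ℝ in 𝓝[>] 0, z + (t : ℂ) * (θ : ℂ) ∉ halfLattice := by
    filter_upwards [Ioo_mem_nhdsGT (show (0 : ℝ) < δ / 2 by positivity)] with t ht hmem
    obtain ⟨n, hn⟩ := mem_halfLattice_iff.1 hmem
    have e : freq n - 2 * z = 2 * (t : ℂ) * (θ : ℂ) := by
      rw [hn]
      ring
    have e2 : ‖freq n - 2 * z‖ = 2 * t := by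
      rw [e, norm_mul, norm_mul, Circle.norm_coe, Complex.norm_ofNat, Complex.norm_real,
        Real.norm_of_nonneg ht.1.le, mul_one]
    have hne : freq n ≠ 2 * z := by
      intro h
      rw [h, sub_self, norm_zero] at e2
      linarith [ht.1]
    linarith [hδ' n hne, ht.2]
  have h := tendsto_sup_limitKernel σ (θ := fun _ => θ) (θ₀ := θ) hz fun n hn =>
    tendsto_const_nhds.congr' (by
      filter_upwards [self_mem_nhdsWithin] with t ht
      exact (hdir n hn t ht).symm)
  refine h.congr' ?_
  filter_upwards [hoff] with t ht
  exact sup_limitKernel_of_notMem ht θ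

theorem limP_eq (σ : ℤˣ) (z : ℂ) (θ : Circle) : limP σ z θ = P σ z ⊔ limitKernel σ z θ :=
  (tendsto_P_ray σ z θ).limUnder_eq

/-- Since `limitKernel` is orthogonal to `P σ z`, it is the complement of `P σ z` in their supremum:
an element of that complement, minus its projection to `limitKernel`, is orthogonal to both
summands, hence to itself. -/
theorem K_eq (σ : ℤˣ) (z : ℂ) (θ : Circle) : K σ z θ = limitKernel σ z θ := by
  rw [K, limP_eq]
  refine le_antisymm (fun ψ hψ => ?_) (le_inf le_sup_right fun φ hφ => ?_)
  · obtain ⟨h1, h2⟩ := ClosedSubmodule.mem_inf.1 hψ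
    have hp := proj_mem (limitKernel σ z θ) ψ
    have hle : limitKernel σ z θ ≤ P σ z ⊔ limitKernel σ z θ := le_sup_right
    have h3 : inner ℝ (ψ - proj (limitKernel σ z θ) ψ) (ψ - proj (limitKernel σ z θ) ψ) = 0 := by
      refine inner_eq_zero_of_mem_sup (V := P σ z) (W := limitKernel σ z θ) (fun v hv => ?_)
        (fun v hv => inner_sub_proj hv) (Submodule.sub_mem (P σ z ⊔ limitKernel σ z θ).toSubmodule
          h1 (hle hp))
      rw [inner_sub_left, inner_limitKernel_P hp hv, sub_zero]
      exact (Submodule.mem_orthogonal' _ _).1 h2 v hv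
    rw [inner_self_eq_zero, sub_eq_zero] at h3
    rw [h3]
    exact hp
  · exact (Submodule.mem_orthogonal' _ _).2 fun v hv => inner_limitKernel_P hφ hv

/-! ### The explicit description over a lattice point -/

/-- A vector in the range of the projection is determined by its coefficients of `1` and `dm ∧ dl`;
`psi1` and `psi2` are those for which this pair is `(1, 0)` and `(0, 1)`. -/
theorem spec_neg_circle (σ : ℤˣ) (θ : Circle) (c : Fin 4 → ℂ) :
    spec σ (-θ) c = spec σ (-θ) c 0 • psi1 σ θ + spec σ (-θ) c 3 • psi2 σ θ := by
  have h1 := unit_mul_self σ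
  have h2 : ((θ : ℂ).re : ℂ) ^ 2 + ((θ : ℂ).im : ℂ) ^ 2 = 1 := by
    rw [← norm_sq_eq, Circle.norm_coe]
    simp
  have h3 : ((σ : ℤ) : ℂ) ^ 2 * Complex.I ^ 2 *
      (((θ : ℂ).re : ℂ) ^ 2 + ((θ : ℂ).im : ℂ) ^ 2) = -1 := by
    rw [h2, Complex.I_sq, sq, h1]
    ring
  funext k
  fin_cases k
  · simp [psi1, psi2]
  · simp [spec, symb, psi1, psi2, Circle.norm_coe]
    linear_combination (c 1 / 2) * h3
  · simp [spec, symb, psi1, psi2, Circle.norm_coe]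
    linear_combination (c 2 / 2) * h3
  · simp [psi1, psi2]

theorem spec_psi1 (σ : ℤˣ) (θ : Circle) : spec σ (-θ) (psi1 σ θ) = psi1 σ θ := by
  have h1 := unit_mul_self σ
  have h2 : ((θ : ℂ).re : ℂ) ^ 2 + ((θ : ℂ).im : ℂ) ^ 2 = 1 := by
    rw [← norm_sq_eq, Circle.norm_coe]
    simp
  have e0 : spec σ (-θ) (psi1 σ θ) 0 = 1 := by
    simp [spec, symb, psi1, Circle.norm_coe]
    linear_combination (-(((σ : ℤ) : ℂ) * ((σ : ℤ) : ℂ)) * Complex.I ^ 2 / 2) * h2 +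
      (-Complex.I ^ 2 / 2) * h1 - (1 / 2 : ℂ) * Complex.I_sq
  have e3 : spec σ (-θ) (psi1 σ θ) 3 = 0 := by
    simp [spec, symb, psi1, Circle.norm_coe]
    ring
  rw [spec_neg_circle, e0, e3, one_smul, zero_smul, add_zero]

theorem spec_psi2 (σ : ℤˣ) (θ : Circle) : spec σ (-θ) (psi2 σ θ) = psi2 σ θ := by
  have h1 := unit_mul_self σ
  have h2 : ((θ : ℂ).re : ℂ) ^ 2 + ((θ : ℂ).im : ℂ) ^ 2 = 1 := by
    rw [← norm_sq_eq, Circle.norm_coe]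
    simp
  have e0 : spec σ (-θ) (psi2 σ θ) 0 = 0 := by
    simp [spec, symb, psi2, Circle.norm_coe]
    ring
  have e3 : spec σ (-θ) (psi2 σ θ) 3 = 1 := by
    simp [spec, symb, psi2, Circle.norm_coe]
    linear_combination (-(((σ : ℤ) : ℂ) * ((σ : ℤ) : ℂ)) * Complex.I ^ 2 / 2) * h2 +
      (-Complex.I ^ 2 / 2) * h1 - (1 / 2 : ℂ) * Complex.I_sq
  rw [spec_neg_circle, e0, e3, one_smul, zero_smul, zero_add]

/-- The volume charges every nonempty open set, so a continuous form is determined by its class;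
evaluate at one point, where the character is nonzero. -/
theorem mode_injective (n : ℤ × ℤ) : Function.Injective (mode n) := by
  have : (volume : Measure Torus).IsOpenPosMeasure := by
    rw [Measure.volume_eq_prod]
    infer_instance
  intro c d h
  have h1 := ContinuousMap.toLp_injective (𝕜 := ℝ) (volume : Measure Torus) h
  have h2 : modeForm n c 0 = modeForm n d 0 := congrArg (fun f : C(Torus, Fibre) => f 0) h1
  have h3 : ∀ k, char n 0 * c k = char n 0 * d k := by
    intro k
    have h4 : mulJ (char n 0 * c k) = mulJ (char n 0 * d k) :=
      congrArg (fun v : Fibre => v k) h2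
    have h5 := congrArg coordJ h4
    exact Complex.ext (congrArg Complex.re h5) (congrArg Complex.im h5)
  funext k
  refine mul_left_cancel₀ (norm_ne_zero_iff.1 ?_) (h3 k)
  rw [norm_char]
  exact one_ne_zero

/-- The constants of the four forms that span `K` over a lattice point. -/
def kernelBasis (σ : ℤˣ) (θ : Circle) : Fin 4 → Fin 4 → ℂ :=
  ![psi1 σ θ, psi2 σ θ, fun k => Complex.I * psi1 σ θ k, fun k => Complex.I * psi2 σ θ k]

theorem linearIndependent_kernelBasis (σ : ℤˣ) (θ : Circle) :
    LinearIndependent ℝ (kernelBasis σ θ) := by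
  rw [Fintype.linearIndependent_iff]
  intro g hg
  rw [Fin.sum_univ_four] at hg
  have h0 := congrFun hg 0
  have h3 := congrFun hg 3
  have v0 : kernelBasis σ θ 0 0 = 1 ∧ kernelBasis σ θ 1 0 = 0 ∧ kernelBasis σ θ 2 0 = Complex.I ∧
      kernelBasis σ θ 3 0 = 0 := by simp [kernelBasis, psi1, psi2]
  have v3 : kernelBasis σ θ 0 3 = 0 ∧ kernelBasis σ θ 1 3 = 1 ∧ kernelBasis σ θ 2 3 = 0 ∧
      kernelBasis σ θ 3 3 = Complex.I := by simp [kernelBasis, psi1, psi2]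
  simp only [Pi.add_apply, Pi.smul_apply, v0, v3, Pi.zero_apply] at h0 h3
  have a0 := congrArg Complex.re h0
  have a1 := congrArg Complex.im h0
  have b0 := congrArg Complex.re h3
  have b1 := congrArg Complex.im h3
  simp at a0 a1 b0 b1
  intro i
  fin_cases i <;> assumption

theorem range_mode_kernelBasis (r s : ℤ) (σ : ℤˣ) (θ : Circle) :
    {expForm r s (psi1 σ θ) qj ⟨rfl, rfl⟩, expForm r s (psi2 σ θ) qj ⟨rfl, rfl⟩,
      expForm r s (psi1 σ θ) qk ⟨rfl, rfl⟩, expForm r s (psi2 σ θ) qk ⟨rfl, rfl⟩} =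
      Set.range (mode (r, s) ∘ kernelBasis σ θ) := by
  rw [expForm_qj, expForm_qj, expForm_qk, expForm_qk]
  ext ψ
  simp only [Set.mem_insert_iff, Set.mem_singleton_iff, Set.mem_range, Fin.exists_fin_succ,
    Function.comp_apply, kernelBasis]
  simp [eq_comm]

theorem mode_spec_mem_span (n : ℤ × ℤ) (σ : ℤˣ) (θ : Circle) (c : Fin 4 → ℂ) :
    mode n (spec σ (-θ) c) ∈ Submodule.span ℝ (Set.range (mode n ∘ kernelBasis σ θ)) := by
  have key : ∀ (a : ℂ) (d : Fin 4 → ℂ), a • d = a.re • d + a.im • fun k => Complex.I * d k := by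
    intro a d
    funext k
    simp only [Pi.smul_apply, Pi.add_apply, smul_eq_mul, Complex.real_smul]
    linear_combination -(d k) * Complex.re_add_im a
  have hmem : ∀ i, mode n (kernelBasis σ θ i) ∈
      Submodule.span ℝ (Set.range (mode n ∘ kernelBasis σ θ)) :=
    fun i => Submodule.subset_span ⟨i, rfl⟩
  rw [spec_neg_circle, key _ (psi1 σ θ), key _ (psi2 σ θ)]
  simp only [map_add, map_smul]
  exact add_mem (add_mem (Submodule.smul_mem _ _ (hmem 0)) (Submodule.smul_mem _ _ (hmem 2)))
    (add_mem (Submodule.smul_mem _ _ (hmem 1)) (Submodule.smul_mem _ _ (hmem 3)))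

theorem spec_kernelBasis (σ : ℤˣ) (θ : Circle) (i : Fin 4) :
    spec σ (-θ) (kernelBasis σ θ i) = kernelBasis σ θ i := by
  fin_cases i
  · exact spec_psi1 σ θ
  · exact spec_psi2 σ θ
  · exact (spec_smul σ _ Complex.I _).trans (congrArg (Complex.I • ·) (spec_psi1 σ θ))
  · exact (spec_smul σ _ Complex.I _).trans (congrArg (Complex.I • ·) (spec_psi2 σ θ))

theorem limitKernel_eq_span {z : ℂ} {n : ℤ × ℤ} (hn : freq n = 2 * z) (σ : ℤˣ) (θ : Circle) :
    (limitKernel σ z θ).toSubmodule =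
      Submodule.span ℝ (Set.range (mode n ∘ kernelBasis σ θ)) := by
  refine le_antisymm ?_ (Submodule.span_le.2 ?_)
  -- The span is finite dimensional, hence closed, so the closure in `limitKernel` adds nothing.
  · have hfin : FiniteDimensional ℝ (Submodule.span ℝ (Set.range (mode n ∘ kernelBasis σ θ))) :=
      FiniteDimensional.span_of_finite ℝ (Set.finite_range _)
    refine Submodule.topologicalClosure_minimal _ (Submodule.span_le.2 ?_)
      (Submodule.closed_of_finiteDimensional _)
    rintro ψ ⟨m, c, hm, rfl⟩
    obtain rfl : m = n := freq_injective (hm.trans hn.symm)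
    exact mode_spec_mem_span m σ θ c
  · rintro ψ ⟨i, rfl⟩
    refine Submodule.le_topologicalClosure _ (Submodule.subset_span ⟨n, kernelBasis σ θ i, hn, ?_⟩)
    rw [spec_kernelBasis]
    rfl

theorem finrank_limitKernel {z : ℂ} {n : ℤ × ℤ} (hn : freq n = 2 * z) (σ : ℤˣ) (θ : Circle) :
    Module.finrank ℝ (limitKernel σ z θ).toSubmodule = 4 := by
  rw [limitKernel_eq_span hn]
  have h := (linearIndependent_kernelBasis σ θ).map' (mode n)
    (LinearMap.ker_eq_bot.2 (mode_injective n))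
  exact (finrank_span_eq_card h).trans (Fintype.card_fin 4)

/-! ### Harmonicity of the limit kernel -/

theorem nablaM_zero (z : ℂ) : nablaM (flatConnection z) 0 = 0 := by
  funext x
  apply su2_ext <;> simp [nablaM, partialM, bracket]

theorem nablaL_zero (z : ℂ) : nablaL (flatConnection z) 0 = 0 := by
  funext x
  apply su2_ext <;> simp [nablaL, partialL, bracket]

/-- Covariantly constant coefficients are killed by `d_a` and its adjoint in every degree. A mode
with `freq n = 2 * z` is of this kind. -/
theorem laplacian_eq_zero {z : ℂ} {f : Form}
    (hM : ∀ k, nablaM (flatConnection z) (fun y => f y k) = 0)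
    (hL : ∀ k, nablaL (flatConnection z) (fun y => f y k) = 0) :
    laplacian (flatConnection z) f = 0 := by
  have hM0 := nablaM_zero z
  have hL0 := nablaL_zero z
  have h00 : d0 (flatConnection z) 0 = 0 := by
    funext x
    exact Prod.ext (congrFun hM0 x) (congrFun hL0 x)
  have h0 : d0 (flatConnection z) (deg0 f) = 0 := by
    funext x
    exact Prod.ext (congrFun (hM 0) x) (congrFun (hL 0) x)
  have h3 : d0 (flatConnection z) (star2 (deg2 f)) = 0 := by
    funext x
    exact Prod.ext (congrFun (hM 3) x) (congrFun (hL 3) x)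
  have h1 : d1 (flatConnection z) (deg1 f) = 0 := by
    funext x
    exact (congrArg₂ (· - ·) (congrFun (hM 2) x) (congrFun (hL 1) x)).trans (sub_zero _)
  have h1' : d1 (flatConnection z) (star1 (deg1 f)) = 0 := by
    funext x
    refine (congrArg₂ (· - ·) (congrFun (hM 1) x)
      ((nablaL_neg _ (fun y => f y 2) x).trans
        (congrArg Neg.neg (congrFun (hL 2) x)))).trans ?_
    simp
  have hs : star1 0 = 0 := by
    funext x
    simp [star1]
  have hd1 : d1 (flatConnection z) 0 = 0 := by
    funext x
    exact (congrArg₂ (· - ·) (congrFun hM0 x) (congrFun hL0 x)).trans (sub_zero _)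
  have hs2 : ∀ γ : Form2, star2 γ = γ := fun _ => rfl
  simp only [hs2] at h3
  simp only [laplacian, codiff1, codiff2, hs2, h0, h1, h1', h3, hs, neg_zero, h00, hd1, add_zero]
  funext x
  refine PiLp.ext fun k => ?_
  fin_cases k <;> rfl

theorem laplacian_modeForm {z : ℂ} {n : ℤ × ℤ} (hn : freq n = 2 * z) (c : Fin 4 → ℂ) :
    laplacian (flatConnection z) (modeForm n c) = 0 := by
  refine laplacian_eq_zero (fun k => funext fun x => ?_) (fun k => funext fun x => ?_)
  · refine (nablaM_char z n (c k) x).trans ?_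
    simp [hn]
  · refine (nablaL_char z n (c k) x).trans ?_
    simp [hn]

theorem limitKernel_subset_harmonicCj (σ : ℤˣ) (z : ℂ) (θ : Circle) :
    (limitKernel σ z θ : Set L2Forms) ⊆ harmonicCj z := by
  intro ψ hψ
  by_cases hz : z ∈ halfLattice
  · obtain ⟨n, hn⟩ := mem_halfLattice_iff.1 hz
    have hψ' : ψ ∈ (limitKernel σ z θ).toSubmodule := hψ
    rw [limitKernel_eq_span hn] at hψ'
    have hle : Submodule.span ℝ (Set.range (mode n ∘ kernelBasis σ θ)) ≤
        LinearMap.range (mode n) := by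
      rw [Submodule.span_le]
      rintro _ ⟨i, rfl⟩
      exact ⟨_, rfl⟩
    obtain ⟨c, rfl⟩ := hle hψ'
    exact ⟨modeForm n c, torusSmooth_modeForm n c, coeFn_mode n c, laplacian_modeForm hn c,
      fun x k => rfl⟩
  · rw [limitKernel_eq_bot hz] at hψ
    obtain rfl : ψ = 0 := hψ
    exact ⟨0, contDiff_const, Lp.coeFn_zero _ _ _,
      laplacian_eq_zero (fun _ => nablaM_zero z) (fun _ => nablaL_zero z), fun x k => rfl⟩

/-! ### Continuity on the blow-up -/

theorem IsCutoff.nonneg {η : ℝ → ℝ} (h : IsCutoff η) (t : ℝ) : 0 ≤ η t := by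
  obtain ⟨-, h0, hb, h1⟩ := h
  rcases le_total t (1 / 8) with ht | ht
  · exact (h0 t ht).ge
  · rcases le_total t (1 / 4) with ht' | ht'
    · exact (hb.mapsTo ⟨ht, ht'⟩).1
    · rw [h1 t ht']
      exact zero_le_one

theorem IsCutoff.le_one {η : ℝ → ℝ} (h : IsCutoff η) (t : ℝ) : η t ≤ 1 := by
  obtain ⟨-, h0, hb, h1⟩ := h
  rcases le_total t (1 / 8) with ht | ht
  · rw [h0 t ht]
    exact zero_le_one
  · rcases le_total t (1 / 4) with ht' | ht'
    · exact (hb.mapsTo ⟨ht, ht'⟩).2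
    · exact (h1 t ht').le

/-- The first component of the collapsing map. -/
def collapsePoint (η : ℝ → ℝ) (z : ℂ) : ℂ :=
  nearest z + (η ‖z - nearest z‖ : ℂ) * (z - nearest z)

/-- The second component of the collapsing map. -/
def collapseAngle (z : ℂ) : Circle := Circle.exp (Complex.arg (z - nearest z))

theorem coe_collapseAngle {z : ℂ} (h : z - nearest z ≠ 0) :
    (collapseAngle z : ℂ) = dir (z - nearest z) := by
  have h' : (‖z - nearest z‖ : ℂ) ≠ 0 := by simpa using h
  rw [collapseAngle, Circle.coe_exp, dir, eq_div_iff h', mul_comm]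
  exact Complex.norm_mul_exp_arg_mul_I _

/-- `nearest` itself jumps, but the distance to the lattice is 1-Lipschitz. -/
theorem continuous_norm_sub_nearest : Continuous fun z : ℂ => ‖z - nearest z‖ := by
  have key : ∀ z w : ℂ, ‖z - nearest z‖ - ‖w - nearest w‖ ≤ ‖z - w‖ := by
    intro z w
    have h1 := norm_sub_nearest_le (z := z) (nearest_mem w)
    have h2 := norm_sub_le_norm_sub_add_norm_sub z w (nearest w)
    linarith
  refine LipschitzWith.continuous (K := 1) (LipschitzWith.of_dist_le_mul fun z w => ?_)
  rw [Real.dist_eq, dist_eq_norm, NNReal.coe_one, one_mul, abs_le]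
  have h1 := key z w
  have h2 := key w z
  rw [norm_sub_rev w z] at h2
  constructor <;> linarith

theorem eventually_nearest_eq {z : ℂ} (h : ‖z - nearest z‖ < 1 / 4) :
    ∀ᶠ w in 𝓝 z, nearest w = nearest z := by
  have hc : Continuous fun w : ℂ => ‖w - nearest z‖ := by fun_prop
  filter_upwards [hc.continuousAt.eventually_lt continuousAt_const h] with w hw
  exact nearest_eq (nearest_mem z) hw

theorem IsCutoff.continuous_collapsePoint {η : ℝ → ℝ} (hη : IsCutoff η) :
    Continuous (collapsePoint η) := by
  refine continuous_iff_continuousAt.2 fun z => ?_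
  have hηc : Continuous η := hη.1.continuous
  rcases lt_or_ge ‖z - nearest z‖ (1 / 4) with h | h
  · have hc : Continuous fun w : ℂ =>
        nearest z + (η ‖w - nearest z‖ : ℂ) * (w - nearest z) := by fun_prop
    refine hc.continuousAt.congr ?_
    filter_upwards [eventually_nearest_eq h] with w hw
    rw [collapsePoint, hw]
  · have h1 : η ‖z - nearest z‖ = 1 := hη.2.2.2 _ h
    -- At distance at least `1 / 4` the nearest point may jump, so the map is written as the
    -- identity minus a correction whose norm depends only on the distance to the lattice and tends
    -- to `0`.
    have e : ∀ w, collapsePoint η w = w - ((1 - η ‖w - nearest w‖ : ℝ) : ℂ) * (w - nearest w) := by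
      intro w
      rw [collapsePoint]
      push_cast
      ring
    have hlim : Tendsto (fun w : ℂ => ((1 - η ‖w - nearest w‖ : ℝ) : ℂ) * (w - nearest w))
        (𝓝 z) (𝓝 0) := by
      rw [tendsto_zero_iff_norm_tendsto_zero]
      have hc : Continuous fun w : ℂ => |1 - η ‖w - nearest w‖| * ‖w - nearest w‖ :=
        ((continuous_const.sub (hηc.comp continuous_norm_sub_nearest)).abs).mul
          continuous_norm_sub_nearest
      have h2 := hc.tendsto z
      simp only [h1, sub_self, abs_zero, zero_mul] at h2
      refine h2.congr fun w => ?_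
      rw [norm_mul, Complex.norm_real, Real.norm_eq_abs]
    have h3 := (tendsto_id (α := ℂ) (x := 𝓝 z)).sub hlim
    have h4 : collapsePoint η z = id z - 0 := by
      rw [e, h1]
      simp
    rw [ContinuousAt, h4]
    exact h3.congr fun w => (e w).symm

/-- If `η` is positive at the distance to the lattice, the shifted frequency is a positive multiple
of `-(z - nearest z)`; if it vanishes, the convention at zero frequency uses the angle of the same
vector. The two cases agree. -/
theorem blowUpDir_collapse {η : ℝ → ℝ} (hη : IsCutoff η) {z : ℂ} (hz : z - nearest z ≠ 0)
    {n : ℤ × ℤ} (hn : freq n = 2 * nearest z) :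
    blowUpDir (collapsePoint η z) (collapseAngle z) n = -dir (z - nearest z) := by
  have e : freq n - 2 * collapsePoint η z =
      ((2 * η ‖z - nearest z‖ : ℝ) : ℂ) * -(z - nearest z) := by
    rw [hn, collapsePoint]
    push_cast
    ring
  unfold blowUpDir
  split_ifs with h
  · rw [coe_collapseAngle hz]
  · rw [← sub_eq_zero, e] at h
    have hpos : 0 < 2 * η ‖z - nearest z‖ := by
      refine lt_of_le_of_ne (mul_nonneg zero_le_two (hη.nonneg _)) fun h0 => h ?_
      rw [← h0]
      simp
    rw [e, dir_mul hpos, dir_neg]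

theorem continuousAt_dir {ξ : ℂ} (h : ξ ≠ 0) : ContinuousAt dir ξ := by
  have h' : (‖ξ‖ : ℂ) ≠ 0 := by simpa using h
  exact continuousAt_id.div (Complex.continuous_ofReal.comp continuous_norm).continuousAt h'

theorem continuous_sup_limitKernel_collapse (σ : ℤˣ) {η : ℝ → ℝ} (hη : IsCutoff η) :
    Continuous fun z : PuncturedPlane => P σ (collapsePoint η z) ⊔
      limitKernel σ (collapsePoint η z) (collapseAngle z) := by
  refine continuous_iff_continuousAt.2 fun z => ?_
  have hne : ∀ w : PuncturedPlane, (w : ℂ) - nearest w ≠ 0 := by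
    intro w h
    have := w.2 _ (nearest_mem w)
    rw [dist_eq_norm, h, norm_zero] at this
    norm_num at this
  refine tendsto_sup_limitKernel σ
    (hη.continuous_collapsePoint.comp continuous_subtype_val).continuousAt fun n hn => ?_
  have hmem := mem_halfLattice_iff.2 ⟨n, hn⟩
  -- From distance `1 / 4` on, the collapse fixes `z`, which would then be a lattice point inside a
  -- removed disk. So a zero frequency occurs only where `nearest` is locally constant.
  have hlt : ‖(z : ℂ) - nearest z‖ < 1 / 4 := by
    by_contra hge
    have h1 : η ‖(z : ℂ) - nearest z‖ = 1 := hη.2.2.2 _ (not_lt.1 hge)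
    have h2 : collapsePoint η z = z := by
      rw [collapsePoint, h1]
      simp
    rw [h2] at hmem
    have := z.2 _ hmem
    rw [dist_self] at this
    norm_num at this
  have heq : collapsePoint η z = nearest z := by
    refine halfLattice_eq hmem (nearest_mem _) ?_
    rw [collapsePoint, add_sub_cancel_left, norm_mul, Complex.norm_real,
      Real.norm_of_nonneg (hη.nonneg _)]
    have := mul_le_mul_of_nonneg_right (hη.le_one ‖(z : ℂ) - nearest z‖)
      (norm_nonneg ((z : ℂ) - nearest z))
    linarith
  rw [heq] at hn
  rw [coe_collapseAngle (hne z)]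
  have hc : ContinuousAt (fun w : PuncturedPlane => -dir ((w : ℂ) - nearest z)) z := by
    have h1 : ContinuousAt (fun w : PuncturedPlane => (w : ℂ) - nearest z) z := by fun_prop
    exact (ContinuousAt.comp (g := dir) (x := z)
      (f := fun w : PuncturedPlane => (w : ℂ) - nearest z) (continuousAt_dir (hne z)) h1).neg
  refine Tendsto.congr' ?_ hc
  filter_upwards [continuous_subtype_val.continuousAt.eventually (eventually_nearest_eq hlt)]
    with w hw
  rw [blowUpDir_collapse hη (hne w) (hn.trans (congrArg (2 * ·) hw.symm)), hw]

/-- The map `(z, θ) ↦ P ⊔ K` on the blow-up. -/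
def blowUpP (σ : ℤˣ) : BlowUp → ClosedSubmodule ℝ L2Forms :=
  Quotient.lift (s := blowUpSetoid) (fun x => P σ x.1 ⊔ limitKernel σ x.1 x.2) (by
    rintro ⟨z, θ⟩ ⟨w, ρ⟩ ⟨h, h'⟩
    obtain rfl : z = w := h
    rcases h' with h' | h'
    · obtain rfl : θ = ρ := h'
      rfl
    · change P σ z ⊔ limitKernel σ z θ = P σ z ⊔ limitKernel σ z ρ
      rw [limitKernel_eq_bot h', limitKernel_eq_bot h'])

theorem blowUpP_mk (σ : ℤˣ) (z : ℂ) (θ : Circle) :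
    blowUpP σ (BlowUp.mk z θ) = P σ z ⊔ limitKernel σ z θ := rfl

theorem continuous_blowUpP (σ : ℤˣ) {η : ℝ → ℝ} (hη : IsCutoff η) :
    Continuous[blowUpTopology η, gapTopology] (blowUpP σ) :=
  continuous_coinduced_dom.2 (continuous_sup_limitKernel_collapse σ hη)

end TorusDeRham

end

open TorusDeRham
theorem theorem3 (σ : ℤˣ) :
    -- continuity off the half-integer lattice
    ContinuousOn (P σ) halfLatticeᶜ ∧
    -- one-sided directional limits and the spaces `K`
    (∀ (z : ℂ) (θ : Circle),
      Tendsto (fun t : ℝ => P σ (z + (t : ℂ) * (θ : ℂ))) (𝓝[>] 0) (𝓝 (limP σ z θ)) ∧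
      P σ z ≤ limP σ z θ ∧
      (K σ z θ : Set L2Forms) ⊆ harmonicCj z ∧
      (z ∉ halfLattice → K σ z θ = ⊥)) ∧
    -- `P ⊕ K` is a well-defined continuous function on the blow-up
    (∃ F : BlowUp → ClosedSubmodule ℝ L2Forms,
      (∀ (z : ℂ) (θ : Circle), F (BlowUp.mk z θ) = P σ z ⊔ K σ z θ) ∧
      ∀ η : ℝ → ℝ, IsCutoff η → Continuous[blowUpTopology η, gapTopology] F) ∧
    -- the explicit description of `K` over a lattice point
    (∀ (r s : ℤ) (θ : Circle),
      (K σ ⟨(r : ℝ) / 2, (s : ℝ) / 2⟩ θ).toSubmodule =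
        Submodule.span ℝ
          {expForm r s (psi1 σ θ) qj ⟨rfl, rfl⟩, expForm r s (psi2 σ θ) qj ⟨rfl, rfl⟩,
            expForm r s (psi1 σ θ) qk ⟨rfl, rfl⟩, expForm r s (psi2 σ θ) qk ⟨rfl, rfl⟩} ∧
      Module.finrank ℝ (K σ ⟨(r : ℝ) / 2, (s : ℝ) / 2⟩ θ).toSubmodule = 4) := by
  refine ⟨continuousOn_P σ, fun z θ => ⟨?_, ?_, ?_, fun hz => ?_⟩, ⟨blowUpP σ, fun z θ => ?_,
    fun η hη => continuous_blowUpP σ hη⟩, fun r s θ => ?_⟩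
  · rw [limP_eq]
    exact tendsto_P_ray σ z θ
  · rw [limP_eq]
    exact le_sup_left
  · rw [K_eq]
    exact limitKernel_subset_harmonicCj σ z θ
  · rw [K_eq, limitKernel_eq_bot hz]
  · rw [K_eq, blowUpP_mk]
  · have hn : freq (r, s) = 2 * (⟨(r : ℝ) / 2, (s : ℝ) / 2⟩ : ℂ) := by
      apply Complex.ext <;> simp [freq] <;> ring
    rw [K_eq]
    refine ⟨?_, finrank_limitKernel hn σ θ⟩
    rw [range_mode_kernelBasis]
    exact limitKernel_eq_span hn σ θ
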